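/- **Setting.** Let $\mathbb K=\mathbb R$ or $\mathbb C$, let $X$ be a Banach space over $\mathbb K$, and let $\mathcal B=\{e_n\}_{n\ge1}\subset X$, $\{e_n^*\}_{n\ge1}\subset X^*$ be a biorthogonal system with $e_n^*(x)\to0$ for all $x\in X$. For finite $A\subset\mathbb N$ put $P_Ax=\sum_{n\in A}e_n^*(x)e_n$. A greedy operator of order $N$ is a map $G:X\to X$ such that for each $x$ there is a set $A$ with $|A|=N$, $\min_{n\in A}|e_n^*(x)|\ge\max_{n\notin A}|e_n^*(x)|$ and $Gx=P_Ax$. For $N\ge1$ put $$\sigma_N(x)=\inf\Big\{\big\|x-\sum_{n\in A}c_ne_n\big\|: |A|\le N,\ c_n\in\mathbb K\Big\},\qquad \tilde\sigma_N(x)=\inf\{\|x-P_Ax\|: |A|\le N\},$$ and let $L_N$, respectively $\tilde L_N$, be the smallest constant $C\in[0,\infty]$ such that $\|x-Gx\|\le C\,\sigma_N(x)$, respectively $\|x-Gx\|\le C\,\tilde\sigma_N(x)$, for all $x\in X$ and all greedy operators $G$ of order $N$. Put $K_N=\sup_{|A|\le N}\|P_A\|$ and $g_N=\sup\{\|Gx\|/\|x\|: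 x\ne0,\ G\text{ a greedy operator of order }n\le N\}$. Let $D(N)$ and $d(N)$ be the supremum and the infimum of $\|\sum_{n\in A}\varepsilon_ne_n\|$ over all $|A|=N$ and $\varepsilon_n\in\mathbb K$ with $|\varepsilon_n|=1$, and let $\mu_N=\sup_{1\le n\le N}D(n)/d(n)$. A star ($D^*(N)$, $L_N^*$, $\tilde L_N^*$, $g_N^*$, $\mu_N^*$) denotes the same quantity for the system $\{e_n^*\}$ in $\widehat X=\overline{\operatorname{span}}\{e_n^*\}\subset X^*$, whose coordinate functionals are the evaluations $\varphi\mapsto\varphi(e_n)$. For sequences $\eta_1,\eta_2$ let $$T_N(\eta_1,\eta_2)=\sum_{j=1}^N\frac{\eta_1(j)}{j}\,\big(\eta_2(j)-\eta_2(j-1)\big)\quad(\text{with }\eta_2(0)=0),\qquad OT_N(\eta_1,\eta_2)=\min\{T_N(\eta_1,\eta_2),T_N(\eta_2,\eta_1)\}.$$ Write $a_N\approx b_N$ if there are constants $0<c,C<\infty$ with $c\,b_N\le a_N\le C\,b_N$ for all $N\ge1$. **Theorem 8.3.** Let $\{\mathbf e_n\}_{n\ge1}$ be the canonical basis of $\ell^1$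 over $\mathbb K$, let $$\mathbf x_n=\mathbf e_n-\tfrac12\mathbf e_{2n+1}-\tfrac12\mathbf e_{2n+2},\qquad n\ge1,$$ be the Lindenstrauss basis, in $\mathbb D=\overline{\operatorname{span}}\{\mathbf x_n\}\subset\ell^1$ with the $\ell^1$ norm, and let its coordinate functionals be the restrictions to $\mathbb D$ of the vectors $\mathbf y_n\in c_0$ given by $\mathbf y_1=\mathbf e_1$, $\mathbf y_2=\mathbf e_2$ and $\mathbf y_n=\mathbf e_n+\tfrac12\mathbf y_{\lfloor(n-1)/2\rfloor}$ for $n\ge3$. For this system all $D(N)$ and $D^*(N)$ are finite and $$OT_N(D,D^*)\approx\ln(N+1).$$ Moreover, $$\tilde L_N\approx1\qquad\text{and}\qquad L_N\approx L_N^*\approx\tilde L_N^*\approx K_N\approx g_N^*\approx\mu_N^*\approx\ln(N+1).$$ -/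

import Mathlib

open scoped NNReal ENNReal

noncomputable section

namespace Greedy

/-! ### Greedy approximation with respect to a system `(e n, f n)`

`X` is a normed space over `𝕜` (the real or complex numbers), `e : ℕ → X` are vectors and
`f : ℕ → StrongDual 𝕜 X` are the coordinate functionals. Vectors are indexed from `0`. Constants which
are suprema or optimal constants take values in `ℝ≥0∞`, so that no convention for unbounded suprema is
needed. -/

section Constants

variable {𝕜 : Type*} [RCLike 𝕜] {X : Type*} [NormedAddCommGroup X] [NormedSpace 𝕜 X]

/-- The signed sum `∑_{n ∈ A} ε_n e_n`. -/
def signedSum (e : ℕ → X) (ε : ℕ → 𝕜) (A : Finset ℕ) : X := ∑ n ∈ A, ε n • e n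

/-- The upper (super-)democracy parameter: the supremum of `‖∑_{n ∈ A} ε_n e_n‖` over `|A| = N` and
unimodular scalars `ε_n`. -/
def upperDem (𝕜 : Type*) [RCLike 𝕜] {X : Type*} [NormedAddCommGroup X] [NormedSpace 𝕜 X]
    (e : ℕ → X) (N : ℕ) : ℝ≥0∞ :=
  ⨆ (A : Finset ℕ) (_ : A.card = N) (ε : ℕ → 𝕜) (_ : ∀ n, ‖ε n‖ = 1), ‖signedSum e ε A‖ₑ

/-- The lower (super-)democracy parameter: the corresponding infimum. -/
def lowerDem (𝕜 : Type*) [RCLike 𝕜] {X : Type*} [NormedAddCommGroup X] [NormedSpace 𝕜 X]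
    (e : ℕ → X) (N : ℕ) : ℝ≥0∞ :=
  ⨅ (A : Finset ℕ) (_ : A.card = N) (ε : ℕ → 𝕜) (_ : ∀ n, ‖ε n‖ = 1), ‖signedSum e ε A‖ₑ

/-- The superdemocracy constants `μ_N = sup_{1 ≤ n ≤ N} D(n) / d(n)`. -/
def superDem (𝕜 : Type*) [RCLike 𝕜] {X : Type*} [NormedAddCommGroup X] [NormedSpace 𝕜 X]
    (e : ℕ → X) (N : ℕ) : ℝ≥0∞ :=
  ⨆ (n : ℕ) (_ : 1 ≤ n) (_ : n ≤ N), upperDem 𝕜 e n / lowerDem 𝕜 e n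

/-- The projection `P_A x = ∑_{n ∈ A} f_n(x) e_n`. -/
def proj (e : ℕ → X) (f : ℕ → StrongDual 𝕜 X) (A : Finset ℕ) : X →L[𝕜] X :=
  ∑ n ∈ A, (f n).smulRight (e n)

/-- The conditionality constants `K_N = sup_{|A| ≤ N} ‖P_A‖`. -/
def condConst (e : ℕ → X) (f : ℕ → StrongDual 𝕜 X) (N : ℕ) : ℝ≥0∞ :=
  ⨆ (A : Finset ℕ) (_ : A.card ≤ N), ‖proj e f A‖ₑ

/-- The error `σ_N(x)` of `N`-term approximation. -/
def sigma (𝕜 : Type*) [RCLike 𝕜] {X : Type*} [NormedAddCommGroup X] [NormedSpace 𝕜 X]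
    (e : ℕ → X) (N : ℕ) (x : X) : ℝ≥0∞ :=
  ⨅ (A : Finset ℕ) (_ : A.card ≤ N) (c : ℕ → 𝕜), ‖x - ∑ n ∈ A, c n • e n‖ₑ

/-- The error of expansional `N`-term approximation. -/
def expSigma (e : ℕ → X) (f : ℕ → StrongDual 𝕜 X) (N : ℕ) (x : X) : ℝ≥0∞ :=
  ⨅ (A : Finset ℕ) (_ : A.card ≤ N), ‖x - proj e f A x‖ₑ

/-- `A` is a greedy set for `x` of order `N`. -/
def IsGreedySet (f : ℕ → StrongDual 𝕜 X) (x : X) (N : ℕ) (A : Finset ℕ) : Prop :=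
  A.card = N ∧ ∀ n ∈ A, ∀ m ∉ A, ‖f m x‖ ≤ ‖f n x‖

/-- `G` is a greedy operator of order `N` (in general neither linear nor continuous). -/
def IsGreedyOperator (e : ℕ → X) (f : ℕ → StrongDual 𝕜 X) (N : ℕ) (G : X → X) : Prop :=
  ∀ x, ∃ A : Finset ℕ, IsGreedySet f x N A ∧ G x = proj e f A x

/-- The Lebesgue-type constant `L_N`: the smallest `C` with `‖x - G x‖ ≤ C σ_N(x)` for all `x` and all
greedy operators `G` of order `N` (it is `∞` if there is no such constant). -/
def lebesgue (e : ℕ → X) (f : ℕ → StrongDual 𝕜 X) (N : ℕ) : ℝ≥0∞ :=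
  sInf {C : ℝ≥0∞ | ∀ (x : X) (G : X → X), IsGreedyOperator e f N G →
    ‖x - G x‖ₑ ≤ C * sigma 𝕜 e N x}

/-- The Lebesgue-type constant for expansional approximation. -/
def expLebesgue (e : ℕ → X) (f : ℕ → StrongDual 𝕜 X) (N : ℕ) : ℝ≥0∞ :=
  sInf {C : ℝ≥0∞ | ∀ (x : X) (G : X → X), IsGreedyOperator e f N G →
    ‖x - G x‖ₑ ≤ C * expSigma e f N x}

/-- The quasi-greedy constants `g_N = sup_{n ≤ N} ‖G_n‖`: the supremum of `‖G x‖ / ‖x‖` over all greedy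
operators `G` of order at most `N` and all `x ≠ 0`. -/
def quasiGreedy (e : ℕ → X) (f : ℕ → StrongDual 𝕜 X) (N : ℕ) : ℝ≥0∞ :=
  ⨆ (n : ℕ) (_ : n ≤ N) (G : X → X) (_ : IsGreedyOperator e f n G) (x : X) (_ : x ≠ 0),
    ‖G x‖ₑ / ‖x‖ₑ

/-! ### The dual system -/

/-- The closed linear span of the coordinate functionals in the dual space. -/
abbrev dualSpan (f : ℕ → StrongDual 𝕜 X) : Submodule 𝕜 (StrongDual 𝕜 X) :=
  (Submodule.span 𝕜 (Set.range f)).topologicalClosure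

/-- The coordinate functionals, as vectors of their closed span. -/
def dualVec (f : ℕ → StrongDual 𝕜 X) (n : ℕ) : dualSpan f :=
  ⟨f n, Submodule.le_topologicalClosure _ (Submodule.subset_span ⟨n, rfl⟩)⟩

/-- The vectors `e n`, as functionals `φ ↦ φ (e n)` on the closed span of the coordinate functionals. -/
def dualFun (e : ℕ → X) (f : ℕ → StrongDual 𝕜 X) (n : ℕ) : StrongDual 𝕜 (dualSpan f) :=
  (NormedSpace.inclusionInDoubleDual 𝕜 X (e n)).comp (dualSpan f).subtypeL

/-! The constants of the dual system, in the closed span of the coordinate functionals with the norm of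
the dual space. -/

/-- `D*(N)`. -/
def upperDemDual (f : ℕ → StrongDual 𝕜 X) : ℕ → ℝ≥0∞ := upperDem 𝕜 (dualVec f)

/-- `μ*_N`. -/
def superDemDual (f : ℕ → StrongDual 𝕜 X) : ℕ → ℝ≥0∞ := superDem 𝕜 (dualVec f)

/-- `L*_N`. -/
def lebesgueDual (e : ℕ → X) (f : ℕ → StrongDual 𝕜 X) : ℕ → ℝ≥0∞ :=
  lebesgue (𝕜 := 𝕜) (dualVec f) (dualFun e f)

/-- The constants `L*_N` for expansional approximation. -/
def expLebesgueDual (e : ℕ → X) (f : ℕ → StrongDual 𝕜 X) : ℕ → ℝ≥0∞ :=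
  expLebesgue (𝕜 := 𝕜) (dualVec f) (dualFun e f)

/-- `g*_N`. -/
def quasiGreedyDual (e : ℕ → X) (f : ℕ → StrongDual 𝕜 X) : ℕ → ℝ≥0∞ :=
  quasiGreedy (𝕜 := 𝕜) (dualVec f) (dualFun e f)

end Constants

/-! ### The quantities attached to a pair of weights `η(1), η(2), …` -/

/-- `Δη(j) = η(j) - η(j-1)` for `j ≥ 1`, with `η(0)` read as `0`. -/
def delta (η : ℕ → ℝ) (j : ℕ) : ℝ := η j - if j = 1 then 0 else η (j - 1)

/-- `T_N(η₁, η₂) = ∑_{j=1}^N (η₁(j) / j) Δη₂(j)`. -/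
def sumT (η₁ η₂ : ℕ → ℝ) (N : ℕ) : ℝ := ∑ j ∈ Finset.Icc 1 N, η₁ j / j * delta η₂ j

/-- The minimum of `T_N(η₁, η₂)` and `T_N(η₂, η₁)`. -/
def minT (η₁ η₂ : ℕ → ℝ) (N : ℕ) : ℝ := min (sumT η₁ η₂ N) (sumT η₂ η₁ N)

/-- `a_N ≈ b_N` for `N = 1, 2, …`: two-sided bounds with positive finite constants. -/
def Comparable (a b : ℕ → ℝ≥0∞) : Prop :=
  ∃ c C : ℝ≥0, 0 < c ∧ 0 < C ∧ ∀ N : ℕ, 1 ≤ N → c * b N ≤ a N ∧ a N ≤ C * b N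

/-- `ln (N + 1)`, as an extended nonnegative number. -/
def logSucc (N : ℕ) : ℝ≥0∞ := ENNReal.ofReal (Real.log (N + 1))

/-! ### The Lindenstrauss basis -/

section Lindenstrauss

variable (𝕜 : Type*) [RCLike 𝕜]

/-- The sequence space `ℓ¹`, indexed from `0`. -/
abbrev ell1 : Type _ := lp (fun _ : ℕ => 𝕜) 1

/-- The canonical vectors of `ℓ¹`. -/
def unitVec (n : ℕ) : ell1 𝕜 := lp.single 1 n (1 : 𝕜)

/-- The Lindenstrauss vectors in `ℓ¹`. Counting from `1` they are
`x_n = e_n - e_{2n+1} / 2 - e_{2n+2} / 2`; counting from `0`, index `k` stands for `n = k + 1`, and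
`2n + 1`, `2n + 2` become `2k + 2`, `2k + 3`. -/
def lindVec (k : ℕ) : ell1 𝕜 :=
  unitVec 𝕜 k - (1 / 2 : 𝕜) • unitVec 𝕜 (2 * k + 2) - (1 / 2 : 𝕜) • unitVec 𝕜 (2 * k + 3)

/-- The closed linear span of the Lindenstrauss vectors in `ℓ¹`. -/
abbrev lindSpace : Submodule 𝕜 (ell1 𝕜) :=
  (Submodule.span 𝕜 (Set.range (lindVec 𝕜))).topologicalClosure

/-- The Lindenstrauss basis of its closed span. -/
def lindBasis (k : ℕ) : lindSpace 𝕜 :=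
  ⟨lindVec 𝕜 k, Submodule.le_topologicalClosure _ (Submodule.subset_span ⟨k, rfl⟩)⟩

/-- The evaluation of a sequence at the index `n`, that is, the functional given by `e_n ∈ c₀`. -/
def evalFun (n : ℕ) : StrongDual 𝕜 (ell1 𝕜) := lp.evalCLM 𝕜 (fun _ : ℕ => 𝕜) 1 n

/-- The functionals on `ℓ¹` given by the vectors `y_n = ∑_j 2^{-j} e_{γ_j(n)}` of `c₀`, where (counting
from `1`) `γ_0(n) = n`, `γ_{j+1}(n) = ⌊(γ_j(n) - 1) / 2⌋` and the sum runs while `γ_j(n) ≥ 1`; that is,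
`y_1 = e_1`, `y_2 = e_2`, and `y_n = e_n + y_{⌊(n-1)/2⌋} / 2` for `n ≥ 3`. Counting from `0`, the
vector `y_{k+2}` is `e_{k+2} + y_{⌊k/2⌋} / 2`. -/
def lindFun : ℕ → StrongDual 𝕜 (ell1 𝕜)
  | 0 => evalFun 𝕜 0
  | 1 => evalFun 𝕜 1
  | k + 2 => evalFun 𝕜 (k + 2) + (1 / 2 : 𝕜) • lindFun (k / 2)
termination_by k => k
decreasing_by omega

/-- The coordinate functionals of the Lindenstrauss basis: the `y_n`, restricted to the closed span. -/
def lindCoord (k : ℕ) : StrongDual 𝕜 (lindSpace 𝕜) := (lindFun 𝕜 k).comp (lindSpace 𝕜).subtypeL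

theorem lindVec_apply (m n : ℕ) : lindVec 𝕜 m n =
    (if n = m then 1 else 0) - (if n = 2 * m + 2 ∨ n = 2 * m + 3 then (1 / 2 : 𝕜) else 0) := by
  simp only [lindVec, unitVec, lp.coeFn_sub, lp.coeFn_smul, Pi.sub_apply, Pi.smul_apply,
    lp.coeFn_single, Pi.single_apply, smul_eq_mul]
  split_ifs <;> first | omega | norm_num

/-- The system is biorthogonal. -/
theorem lindCoord_lindBasis (n m : ℕ) :
    lindCoord 𝕜 n (lindBasis 𝕜 m) = if n = m then 1 else 0 := by
  change lindFun 𝕜 n (lindVec 𝕜 m) = _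
  induction n using Nat.strong_induction_on with
  | _ n ih =>
    match n with
    | 0 =>
      rw [lindFun]
      change lindVec 𝕜 m 0 = _
      rw [lindVec_apply, if_neg (c := 0 = 2 * m + 2 ∨ 0 = 2 * m + 3) (by omega), sub_zero]
    | 1 =>
      rw [lindFun]
      change lindVec 𝕜 m 1 = _
      rw [lindVec_apply, if_neg (c := 1 = 2 * m + 2 ∨ 1 = 2 * m + 3) (by omega), sub_zero]
    | k + 2 =>
      rw [lindFun, add_apply, smul_apply,
        ih (k / 2) (by omega)]
      change lindVec 𝕜 m (k + 2) + _ = _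
      rw [lindVec_apply]
      by_cases h : k / 2 = m
      · rw [if_pos h, if_pos (c := k + 2 = 2 * m + 2 ∨ k + 2 = 2 * m + 3) (by omega)]
        simp
      · rw [if_neg h, if_neg (c := k + 2 = 2 * m + 2 ∨ k + 2 = 2 * m + 3) (by omega)]
        simp

end Lindenstrauss

end Greedy

end

noncomputable section

namespace Greedy

open Filter Topology

section General

variable {𝕜 : Type*} [RCLike 𝕜] {X : Type*} [NormedAddCommGroup X] [NormedSpace 𝕜 X]
  {e : ℕ → X} {f : ℕ → StrongDual 𝕜 X} {N : ℕ}

theorem proj_apply (A : Finset ℕ) (x : X) : proj e f A x = ∑ n ∈ A, f n x • e n := by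
  simp [proj]

theorem coord_sum (hef : ∀ n m, f n (e m) = if n = m then 1 else 0) (A : Finset ℕ) (c : ℕ → 𝕜)
    (n : ℕ) : f n (∑ m ∈ A, c m • e m) = if n ∈ A then c n else 0 := by
  simp [map_sum, hef]

theorem proj_sum (hef : ∀ n m, f n (e m) = if n = m then 1 else 0) (A B : Finset ℕ) (c : ℕ → 𝕜) :
    proj e f A (∑ m ∈ B, c m • e m) = ∑ m ∈ A ∩ B, c m • e m := by
  rw [proj_apply, ← Finset.filter_mem_eq_inter, Finset.sum_filter]
  refine Finset.sum_congr rfl fun n _ => ?_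
  rw [coord_sum hef]
  split_ifs <;> simp

/-- Functionals which are bounded as a sequence and vanish in the limit on each vector of a system
vanish in the limit on its closed linear span. -/
theorem tendsto_zero_of_mem_closure_span {v : ℕ → X} {C : ℝ} (hC : ∀ n, ‖f n‖ ≤ C)
    (hv : ∀ m, Tendsto (fun n => f n (v m)) atTop (𝓝 0)) {x : X}
    (hx : x ∈ (Submodule.span 𝕜 (Set.range v)).topologicalClosure) :
    Tendsto (fun n => f n x) atTop (𝓝 0) := by
  have hspan : ∀ y ∈ Submodule.span 𝕜 (Set.range v),
      Tendsto (fun n => f n y) atTop (𝓝 0) := by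
    intro y hy
    induction hy using Submodule.span_induction with
    | mem y hy => obtain ⟨m, rfl⟩ := hy; exact hv m
    | zero => simp
    | add y z _ _ h1 h2 => simpa using h1.add h2
    | smul a y _ h => simpa using h.const_mul a
  have hC0 : 0 ≤ C := (norm_nonneg _).trans (hC 0)
  rw [Metric.tendsto_atTop]
  intro ε hε
  obtain ⟨y, hy, hxy⟩ := Metric.mem_closure_iff.1
    (show x ∈ closure (Submodule.span 𝕜 (Set.range v) : Set X) from hx)
    (ε / (2 * (C + 1))) (by positivity)
  obtain ⟨M, hM⟩ := Metric.tendsto_atTop.1 (hspan y hy) (ε / 2) (by positivity)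
  refine ⟨M, fun n hn => ?_⟩
  have h1 := hM n hn
  rw [dist_zero_right] at h1 ⊢
  rw [dist_eq_norm, lt_div_iff₀ (by positivity)] at hxy
  have h2 : ‖f n (x - y)‖ ≤ (C + 1) * ‖x - y‖ :=
    (f n).le_of_opNorm_le ((hC n).trans (by linarith)) _
  calc ‖f n x‖ = ‖f n (x - y) + f n y‖ := by rw [← map_add, sub_add_cancel]
    _ ≤ ‖f n (x - y)‖ + ‖f n y‖ := norm_add_le _ _
    _ < ε := by nlinarith

theorem exists_isGreedySet {x : X} (hx : Tendsto (fun n => f n x) atTop (𝓝 0)) (N : ℕ) :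
    ∃ A, IsGreedySet f x N A := by
  induction N with
  | zero => exact ⟨∅, by simp [IsGreedySet]⟩
  | succ N ih =>
    obtain ⟨A, hA, hgr⟩ := ih
    obtain ⟨n, hn, hmax⟩ : ∃ n ∉ A, ∀ m ∉ A, ‖f m x‖ ≤ ‖f n x‖ := by
      by_cases h0 : ∀ m ∉ A, f m x = 0
      · obtain ⟨n, hn⟩ := Infinite.exists_notMem_finset A
        exact ⟨n, hn, fun m hm => by rw [h0 m hm, h0 n hn]⟩
      · push Not at h0
        obtain ⟨k, hk, hk0⟩ := h0
        obtain ⟨M, hM⟩ := Metric.tendsto_atTop.1 hx ‖f k x‖ (norm_pos_iff.2 hk0)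
        simp only [dist_zero_right] at hM
        have hkM : k < M := not_le.1 fun h => lt_irrefl _ (hM k h)
        obtain ⟨n, hn, hmax⟩ := Finset.exists_max_image (Finset.range M \ A) (fun m => ‖f m x‖)
          ⟨k, by simp [hkM, hk]⟩
        simp only [Finset.mem_sdiff, Finset.mem_range] at hn hmax
        refine ⟨n, hn.2, fun m hm => ?_⟩
        by_cases hmM : m < M
        · exact hmax m ⟨hmM, hm⟩
        · exact (hM m (not_lt.1 hmM)).le.trans (hmax k ⟨hkM, hk⟩)
    refine ⟨insert n A, by rw [Finset.card_insert_of_notMem hn, hA], fun i hi m hm => ?_⟩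
    simp only [Finset.mem_insert, not_or] at hi hm
    rcases hi with rfl | hi
    · exact hmax m hm.2
    · exact hgr i hi m hm.2

theorem exists_isGreedyOperator (hf : ∀ x, Tendsto (fun n => f n x) atTop (𝓝 0)) {x : X}
    {A : Finset ℕ} (hA : IsGreedySet f x N A) :
    ∃ G, IsGreedyOperator e f N G ∧ G x = proj e f A x := by
  classical
  choose S hS using fun y => exists_isGreedySet (hf y) N
  refine ⟨fun y => proj e f (Function.update S x A y) y, fun y => ⟨_, ?_, rfl⟩, by simp⟩
  by_cases h : y = x
  · subst h; simpa using hA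
  · simpa [h] using hS y

theorem ofReal_le_lebesgue (hf : ∀ x, Tendsto (fun n => f n x) atTop (𝓝 0)) {x : X}
    {A B : Finset ℕ} (hA : IsGreedySet f x N A) (hB : B.card ≤ N) (c : ℕ → 𝕜) {r s : ℝ}
    (hr : r * s ≤ ‖x - proj e f A x‖) (hs : 0 < s) (hxs : ‖x - ∑ n ∈ B, c n • e n‖ ≤ s) :
    ENNReal.ofReal r ≤ lebesgue e f N := by
  refine le_sInf fun C hC => ?_
  obtain ⟨G, hG, hGx⟩ := exists_isGreedyOperator (e := e) hf hA
  have h := hC x G hG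
  have hsig : sigma 𝕜 e N x ≤ ENNReal.ofReal s := by
    refine (iInf₂_le B hB).trans ((iInf_le _ c).trans ?_)
    rw [← ofReal_norm]
    exact ENNReal.ofReal_le_ofReal hxs
  have h2 : ENNReal.ofReal r * ENNReal.ofReal s ≤ C * ENNReal.ofReal s := by
    rw [← ENNReal.ofReal_mul' hs.le]
    refine le_trans ?_ (h.trans (by gcongr))
    rw [hGx, ← ofReal_norm]
    exact ENNReal.ofReal_le_ofReal hr
  exact (ENNReal.mul_le_mul_iff_left (by simpa using hs) ENNReal.ofReal_ne_top).1 h2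

theorem ofReal_le_expLebesgue (hf : ∀ x, Tendsto (fun n => f n x) atTop (𝓝 0)) {x : X}
    {A B : Finset ℕ} (hA : IsGreedySet f x N A) (hB : B.card ≤ N) {r s : ℝ}
    (hr : r * s ≤ ‖x - proj e f A x‖) (hs : 0 < s) (hxs : ‖x - proj e f B x‖ ≤ s) :
    ENNReal.ofReal r ≤ expLebesgue e f N := by
  refine le_sInf fun C hC => ?_
  obtain ⟨G, hG, hGx⟩ := exists_isGreedyOperator (e := e) hf hA
  have h := hC x G hG
  have hsig : expSigma e f N x ≤ ENNReal.ofReal s := by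
    refine (iInf₂_le B hB).trans ?_
    rw [← ofReal_norm]
    exact ENNReal.ofReal_le_ofReal hxs
  have h2 : ENNReal.ofReal r * ENNReal.ofReal s ≤ C * ENNReal.ofReal s := by
    rw [← ENNReal.ofReal_mul' hs.le]
    refine le_trans ?_ (h.trans (by gcongr))
    rw [hGx, ← ofReal_norm]
    exact ENNReal.ofReal_le_ofReal hr
  exact (ENNReal.mul_le_mul_iff_left (by simpa using hs) ENNReal.ofReal_ne_top).1 h2

theorem expLebesgue_le_lebesgue : expLebesgue e f N ≤ lebesgue e f N := by
  refine sInf_le_sInf fun C hC x G hG => (hC x G hG).trans ?_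
  gcongr
  refine le_iInf₂ fun A hA => (iInf₂_le A hA).trans ((iInf_le _ fun n => f n x).trans ?_)
  rw [proj_apply]

theorem lebesgue_le {C : ℝ} (hC : 0 < C)
    (h : ∀ (x : X) (A B : Finset ℕ) (c : ℕ → 𝕜), IsGreedySet f x N A → B.card ≤ N →
      ‖x - proj e f A x‖ ≤ C * ‖x - ∑ n ∈ B, c n • e n‖) :
    lebesgue e f N ≤ ENNReal.ofReal C := by
  refine sInf_le fun x G hG => ?_
  obtain ⟨A, hA, hGx⟩ := hG x
  have hC0 : ENNReal.ofReal C ≠ 0 := by simpa using hC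
  rw [← ENNReal.div_le_iff' hC0 ENNReal.ofReal_ne_top]
  refine le_iInf₂ fun B hB => le_iInf fun c => ?_
  rw [ENNReal.div_le_iff' hC0 ENNReal.ofReal_ne_top, hGx, ← ofReal_norm, ← ofReal_norm,
    ← ENNReal.ofReal_mul hC.le]
  exact ENNReal.ofReal_le_ofReal (h x A B c hA hB)

theorem expLebesgue_le {C : ℝ} (hC : 0 < C)
    (h : ∀ (x : X) (A B : Finset ℕ), IsGreedySet f x N A → B.card ≤ N →
      ‖x - proj e f A x‖ ≤ C * ‖x - proj e f B x‖) :
    expLebesgue e f N ≤ ENNReal.ofReal C := by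
  refine sInf_le fun x G hG => ?_
  obtain ⟨A, hA, hGx⟩ := hG x
  have hC0 : ENNReal.ofReal C ≠ 0 := by simpa using hC
  rw [← ENNReal.div_le_iff' hC0 ENNReal.ofReal_ne_top]
  refine le_iInf₂ fun B hB => ?_
  rw [ENNReal.div_le_iff' hC0 ENNReal.ofReal_ne_top, hGx, ← ofReal_norm, ← ofReal_norm,
    ← ENNReal.ofReal_mul hC.le]
  exact ENNReal.ofReal_le_ofReal (h x A B hA hB)

/-- `‖P_F x‖ ≤ R ‖z‖` whenever `|F| ≤ N` and the coefficients of `x` on `F` are dominated by those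
of `z` on a set `E` which is at least as large as `F`. -/
def DominationBound (e : ℕ → X) (f : ℕ → StrongDual 𝕜 X) (N : ℕ) (R : ℝ) : Prop :=
  ∀ (x z : X) (E F : Finset ℕ) (t : ℝ), F.card ≤ N → F.card ≤ E.card →
    (∀ n ∈ F, ‖f n x‖ ≤ t) → (∀ n ∈ E, t ≤ ‖f n z‖) → ‖proj e f F x‖ ≤ R * ‖z‖

theorem DominationBound.norm_proj_sdiff_le {R : ℝ} (hR : DominationBound e f N R) {x z : X}
    {A B : Finset ℕ} (hA : IsGreedySet f x N A) (hB : B.card ≤ N)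
    (hz : ∀ n ∉ B, f n z = f n x) : ‖proj e f (B \ A) x‖ ≤ R * ‖z‖ := by
  have hcard : (B \ A).card ≤ (A \ B).card := by
    have h1 := Finset.card_sdiff_add_card_inter A B
    have h2 := Finset.card_sdiff_add_card_inter B A
    rw [Finset.inter_comm] at h2
    have := hA.1
    omega
  have hN : (B \ A).card ≤ N := (Finset.card_le_card Finset.sdiff_subset).trans hB
  rcases (A \ B).eq_empty_or_nonempty with h | h
  · have h' : B \ A = ∅ := by rw [h] at hcard; simpa using hcard
    exact hR x z (A \ B) (B \ A) 0 hN hcard (by simp [h']) (by simp [h])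
  · obtain ⟨k, hk, hmin⟩ := Finset.exists_min_image _ (fun n => ‖f n x‖) h
    refine hR x z (A \ B) (B \ A) ‖f k x‖ hN hcard (fun n hn => ?_) fun n hn => ?_
    · exact hA.2 k (Finset.mem_sdiff.1 hk).1 n (Finset.mem_sdiff.1 hn).2
    · rw [hz n (Finset.mem_sdiff.1 hn).2]
      exact hmin n hn

theorem DominationBound.lebesgue_le (hef : ∀ n m, f n (e m) = if n = m then 1 else 0) {K R : ℝ}
    (hK : ∀ A : Finset ℕ, A.card ≤ 2 * N → ‖proj e f A‖ ≤ K) (hK0 : 0 ≤ K) (hR0 : 0 ≤ R)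
    (hR : DominationBound e f N R) : lebesgue e f N ≤ ENNReal.ofReal (1 + K + R) := by
  refine Greedy.lebesgue_le (by positivity) fun x A B c hA hB => ?_
  set z := x - ∑ n ∈ B, c n • e n with hz
  have h1 := hR.norm_proj_sdiff_le hA hB (z := z) fun n hn => by
    rw [hz, map_sub, coord_sum hef, if_neg hn, sub_zero]
  have h2 : ‖proj e f (A ∪ B) z‖ ≤ K * ‖z‖ := by
    refine (proj e f (A ∪ B)).le_of_opNorm_le (hK _ ?_) _
    have := Finset.card_union_le A B
    have := hA.1
    omega
  have h3 : x - proj e f A x = z - proj e f (A ∪ B) z + proj e f (B \ A) x := by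
    have h4 : proj e f (A ∪ B) x = proj e f A x + proj e f (B \ A) x := by
      rw [proj_apply, proj_apply, proj_apply, ← Finset.sum_union Finset.disjoint_sdiff,
        Finset.union_sdiff_self_eq_union]
    rw [hz, map_sub, proj_sum hef, h4, Finset.inter_eq_right.2 Finset.subset_union_right]
    abel
  rw [h3]
  calc _ ≤ ‖z‖ + ‖proj e f (A ∪ B) z‖ + ‖proj e f (B \ A) x‖ :=
        (norm_add_le _ _).trans (by gcongr; exact norm_sub_le _ _)
    _ ≤ _ := by linarith

theorem DominationBound.expLebesgue_le (hef : ∀ n m, f n (e m) = if n = m then 1 else 0) {Q R : ℝ}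
    (hQ : ∀ x M A, IsGreedySet f x M A → ‖proj e f A x‖ ≤ Q * ‖x‖) (hQ0 : 0 ≤ Q) (hR0 : 0 ≤ R)
    (hR : DominationBound e f N R) : expLebesgue e f N ≤ ENNReal.ofReal (1 + Q + R) := by
  refine Greedy.expLebesgue_le (by positivity) fun x A B hA hB => ?_
  set z := x - proj e f B x with hz
  have hfz : ∀ n, f n z = if n ∈ B then 0 else f n x := fun n => by
    rw [hz, map_sub, proj_apply, coord_sum hef]
    split_ifs <;> simp
  have h1 := hR.norm_proj_sdiff_le hA hB (z := z) fun n hn => by rw [hfz, if_neg hn]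
  have h2 : ‖proj e f (A \ B) z‖ ≤ Q * ‖z‖ := by
    refine hQ z _ (A \ B) ⟨rfl, fun n hn m hm => ?_⟩
    simp only [Finset.mem_sdiff, not_and, not_not] at hn hm
    rw [hfz, hfz, if_neg hn.2]
    split_ifs with h
    · simp
    · exact hA.2 n hn.1 m fun h' => h (hm h')
  have h3 : x - proj e f A x = z - proj e f (A \ B) z + proj e f (B \ A) x := by
    have h4 : proj e f (A \ B) z = proj e f (A \ B) x := by
      rw [proj_apply, proj_apply]
      exact Finset.sum_congr rfl fun n hn => by rw [hfz, if_neg (Finset.mem_sdiff.1 hn).2]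
    have h5 : ∀ A B : Finset ℕ, proj e f A x = proj e f (A \ B) x + proj e f (A ∩ B) x :=
      fun A B => by
        rw [proj_apply, proj_apply, proj_apply, ← Finset.sum_union
          (Finset.disjoint_sdiff_inter A B), Finset.sdiff_union_inter]
    rw [h4, hz, h5 A B, h5 B A, Finset.inter_comm]
    abel
  rw [h3]
  calc _ ≤ ‖z‖ + ‖proj e f (A \ B) z‖ + ‖proj e f (B \ A) x‖ :=
        (norm_add_le _ _).trans (by gcongr; exact norm_sub_le _ _)
    _ ≤ _ := by linarith

theorem condConst_le {K : ℝ} (hK : ∀ A : Finset ℕ, A.card ≤ N → ‖proj e f A‖ ≤ K) :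
    condConst e f N ≤ ENNReal.ofReal K :=
  iSup₂_le fun A hA => by
    rw [← ofReal_norm]
    exact ENNReal.ofReal_le_ofReal (hK A hA)

theorem ofReal_le_condConst {A : Finset ℕ} (hA : A.card ≤ N) {r : ℝ} {x : X} (hx : x ≠ 0)
    (h : r * ‖x‖ ≤ ‖proj e f A x‖) : ENNReal.ofReal r ≤ condConst e f N := by
  refine le_trans ?_ (le_iSup₂ (f := fun (A : Finset ℕ) (_ : A.card ≤ N) => ‖proj e f A‖ₑ) A hA)
  rw [← ofReal_norm]
  exact ENNReal.ofReal_le_ofReal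
    (le_of_mul_le_mul_right (h.trans ((proj e f A).le_opNorm x)) (norm_pos_iff.2 hx))

theorem quasiGreedy_le {K : ℝ} (hK : ∀ A : Finset ℕ, A.card ≤ N → ‖proj e f A‖ ≤ K)
    (hK0 : 0 ≤ K) : quasiGreedy e f N ≤ ENNReal.ofReal K := by
  refine iSup₂_le fun n hn => iSup₂_le fun G hG => iSup₂_le fun x hx => ?_
  obtain ⟨A, hA, hGx⟩ := hG x
  rw [ENNReal.div_le_iff (by simpa using hx) (by simp), hGx, ← ofReal_norm, ← ofReal_norm,
    ← ENNReal.ofReal_mul hK0]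
  exact ENNReal.ofReal_le_ofReal ((proj e f A).le_of_opNorm_le (hK A (hA.1.le.trans hn)) x)

theorem ofReal_le_quasiGreedy (hf : ∀ x, Tendsto (fun n => f n x) atTop (𝓝 0)) {n : ℕ}
    (hn : n ≤ N) {x : X} (hx : x ≠ 0) {A : Finset ℕ} (hA : IsGreedySet f x n A) {r : ℝ}
    (h : r * ‖x‖ ≤ ‖proj e f A x‖) : ENNReal.ofReal r ≤ quasiGreedy e f N := by
  obtain ⟨G, hG, hGx⟩ := exists_isGreedyOperator (e := e) hf hA
  refine le_trans ?_ (le_iSup₂_of_le n hn (le_iSup₂_of_le G hG (le_iSup₂_of_le x hx le_rfl)))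
  rw [ENNReal.le_div_iff_mul_le (by simp [hx]) (by simp), hGx, ← ofReal_norm, ← ofReal_norm,
    ← ENNReal.ofReal_mul' (norm_nonneg _)]
  exact ENNReal.ofReal_le_ofReal h

theorem upperDem_le {C : ℝ} (h : ∀ (A : Finset ℕ) (ε : ℕ → 𝕜), A.card = N → (∀ n, ‖ε n‖ = 1) →
    ‖signedSum e ε A‖ ≤ C) : upperDem 𝕜 e N ≤ ENNReal.ofReal C :=
  iSup₂_le fun A hA => iSup₂_le fun ε hε => by
    rw [← ofReal_norm]
    exact ENNReal.ofReal_le_ofReal (h A ε hA hε)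

theorem ofReal_le_upperDem {C : ℝ} {A : Finset ℕ} (hA : A.card = N)
    (h : C ≤ ‖∑ n ∈ A, e n‖) : ENNReal.ofReal C ≤ upperDem 𝕜 e N := by
  refine le_trans ?_ (le_iSup₂_of_le A hA (le_iSup₂_of_le (fun _ => (1 : 𝕜)) (by simp) le_rfl))
  rw [← ofReal_norm]
  exact ENNReal.ofReal_le_ofReal (by simpa [signedSum] using h)

theorem lowerDem_le {C : ℝ} {A : Finset ℕ} (hA : A.card = N)
    (h : ‖∑ n ∈ A, e n‖ ≤ C) : lowerDem 𝕜 e N ≤ ENNReal.ofReal C := by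
  refine le_trans
    (iInf₂_le_of_le A hA (iInf₂_le_of_le (fun _ => (1 : 𝕜)) (by simp) le_rfl)) ?_
  rw [← ofReal_norm]
  exact ENNReal.ofReal_le_ofReal (by simpa [signedSum] using h)

theorem ofReal_le_lowerDem {C : ℝ} (h : ∀ (A : Finset ℕ) (ε : ℕ → 𝕜), A.card = N →
    (∀ n, ‖ε n‖ = 1) → C ≤ ‖signedSum e ε A‖) : ENNReal.ofReal C ≤ lowerDem 𝕜 e N :=
  le_iInf₂ fun A hA => le_iInf₂ fun ε hε => by
    rw [← ofReal_norm]
    exact ENNReal.ofReal_le_ofReal (h A ε hA hε)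

theorem dualFun_dualVec (hef : ∀ n m, f n (e m) = if n = m then 1 else 0) (n m : ℕ) :
    dualFun e f n (dualVec f m) = if n = m then 1 else 0 := by
  change f m (e n) = _
  rw [hef]
  simp only [eq_comm]

theorem tendsto_dualFun (hef : ∀ n m, f n (e m) = if n = m then 1 else 0) {C : ℝ}
    (hC : ∀ n, ‖e n‖ ≤ C) (φ : dualSpan f) :
    Tendsto (fun n => dualFun e f n φ) atTop (𝓝 0) := by
  refine tendsto_zero_of_mem_closure_span (𝕜 := 𝕜) (v := f)
    (f := fun n => NormedSpace.inclusionInDoubleDual 𝕜 X (e n)) (C := C)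
    (fun n => (NormedSpace.double_dual_bound 𝕜 X (e n)).trans (hC n)) (fun m => ?_) φ.2
  refine tendsto_const_nhds.congr' ?_
  filter_upwards [eventually_gt_atTop m] with n hn
  change 0 = f m (e n)
  rw [hef, if_neg hn.ne]

theorem coe_proj_dual (A : Finset ℕ) (φ : dualSpan f) :
    (proj (𝕜 := 𝕜) (dualVec f) (dualFun e f) A φ : StrongDual 𝕜 X) = (φ : StrongDual 𝕜 X).comp
      (proj e f A) := by
  ext x
  rw [proj_apply, ContinuousLinearMap.comp_apply, proj_apply, map_sum]
  rw [AddSubmonoidClass.coe_finsetSum, _root_.sum_apply]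
  refine Finset.sum_congr rfl fun n _ => ?_
  change φ.1 (e n) • f n x = φ.1 (f n x • e n)
  rw [map_smul, smul_eq_mul, smul_eq_mul, mul_comm]

theorem norm_proj_dual_le (A : Finset ℕ) :
    ‖proj (𝕜 := 𝕜) (dualVec f) (dualFun e f) A‖ ≤ ‖proj e f A‖ := by
  refine ContinuousLinearMap.opNorm_le_bound _ (norm_nonneg _) fun φ => ?_
  have h := ContinuousLinearMap.opNorm_comp_le (φ : StrongDual 𝕜 X) (proj e f A)
  rw [← coe_proj_dual, mul_comm] at h
  exact h

end General

theorem comparable_logSucc {a : ℕ → ℝ≥0∞} {c C : ℝ} (hc : 0 < c) (hC : 0 < C)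
    (h₁ : ∀ N : ℕ, 1 ≤ N → ENNReal.ofReal (c * Real.log (N + 1)) ≤ a N)
    (h₂ : ∀ N : ℕ, 1 ≤ N → a N ≤ ENNReal.ofReal (C * Real.log (N + 1))) :
    Comparable a logSucc := by
  refine ⟨c.toNNReal, C.toNNReal, by simpa, by simpa, fun N hN => ⟨?_, ?_⟩⟩
  · refine le_trans (le_of_eq ?_) (h₁ N hN)
    rw [ENNReal.ofReal_mul hc.le]; rfl
  · refine (h₂ N hN).trans (le_of_eq ?_)
    rw [ENNReal.ofReal_mul hC.le]; rfl

/-! ### Weights on the binary forest -/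

/-- The value of the `n`-th coordinate functional of the Lindenstrauss basis at the `k`-th canonical
vector: `2⁻ᵈ` if `k` is the `d`-th ancestor of `n`, and `0` if it is no ancestor. -/
def forestWeight (k : ℕ) : ℕ → ℝ
  | 0 => if 0 = k then 1 else 0
  | 1 => if 1 = k then 1 else 0
  | n + 2 => (if n + 2 = k then 1 else 0) + forestWeight k (n / 2) / 2
termination_by n => n
decreasing_by omega

/-- The weight `2⁻ᵈ` on the nodes of level `d`. -/
def levelWeight : ℕ → ℝ
  | 0 => 1
  | 1 => 1
  | n + 2 => levelWeight (n / 2) / 2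
termination_by n => n
decreasing_by omega

/-- The sign `(-1)ᵈ` on the nodes of level `d`. -/
def levelSign : ℕ → ℝ
  | 0 => 1
  | 1 => 1
  | n + 2 => -levelSign (n / 2)
termination_by n => n
decreasing_by omega

theorem forestWeight_add_two (k n : ℕ) :
    forestWeight k (n + 2) = (if n + 2 = k then 1 else 0) + forestWeight k (n / 2) / 2 := by
  rw [forestWeight]

theorem levelWeight_add_two (n : ℕ) : levelWeight (n + 2) = levelWeight (n / 2) / 2 := by
  rw [levelWeight]

theorem levelSign_add_two (n : ℕ) : levelSign (n + 2) = -levelSign (n / 2) := by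
  rw [levelSign]

theorem forestWeight_zero (k : ℕ) : forestWeight k 0 = if 0 = k then 1 else 0 := by
  rw [forestWeight]

theorem forestWeight_one (k : ℕ) : forestWeight k 1 = if 1 = k then 1 else 0 := by
  rw [forestWeight]

@[simp] theorem levelWeight_zero : levelWeight 0 = 1 := by rw [levelWeight]

@[simp] theorem levelWeight_one : levelWeight 1 = 1 := by rw [levelWeight]

@[simp] theorem levelSign_zero : levelSign 0 = 1 := by rw [levelSign]

@[simp] theorem levelSign_one : levelSign 1 = 1 := by rw [levelSign]

/-- Induction along the branches of the forest. -/
theorem forest_induction {P : ℕ → Prop} (h0 : P 0) (h1 : P 1) (h2 : ∀ n, P (n / 2) → P (n + 2))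
    (n : ℕ) : P n := by
  induction n using Nat.strong_induction_on with
  | _ n ih =>
    match n with
    | 0 => exact h0
    | 1 => exact h1
    | n + 2 => exact h2 n (ih _ (by omega))

theorem forestWeight_nonneg (k n : ℕ) : 0 ≤ forestWeight k n := by
  induction n using forest_induction with
  | h0 => rw [forestWeight]; positivity
  | h1 => rw [forestWeight]; positivity
  | h2 n ih => rw [forestWeight]; positivity

theorem forestWeight_eq_zero {k n : ℕ} (h : n < k) : forestWeight k n = 0 := by
  induction n using forest_induction with
  | h0 => rw [forestWeight, if_neg h.ne]
  | h1 => rw [forestWeight, if_neg h.ne]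
  | h2 n ih => rw [forestWeight, if_neg h.ne, ih (by omega)]; norm_num

theorem forestWeight_self (k : ℕ) : forestWeight k k = 1 := by
  match k with
  | 0 => simp [forestWeight]
  | 1 => simp [forestWeight]
  | n + 2 =>
    rw [forestWeight_add_two, forestWeight_eq_zero (by omega : n / 2 < n + 2)]
    simp

theorem forestWeight_le_one (k n : ℕ) : forestWeight k n ≤ 1 := by
  induction n using forest_induction with
  | h0 => rw [forestWeight]; split_ifs <;> norm_num
  | h1 => rw [forestWeight]; split_ifs <;> norm_num
  | h2 n ih =>
    rw [forestWeight]
    split_ifs with h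
    · rw [forestWeight_eq_zero (by omega)]; norm_num
    · linarith

theorem levelWeight_pos (n : ℕ) : 0 < levelWeight n := by
  induction n using forest_induction with
  | h0 => simp
  | h1 => simp
  | h2 n ih => rw [levelWeight]; positivity

theorem levelWeight_le_one (n : ℕ) : levelWeight n ≤ 1 := by
  induction n using forest_induction with
  | h0 => simp
  | h1 => simp
  | h2 n ih => rw [levelWeight]; linarith

theorem levelSign_cases (n : ℕ) : levelSign n = 1 ∨ levelSign n = -1 := by
  induction n using forest_induction with
  | h0 => simp
  | h1 => simp
  | h2 n ih => rw [levelSign]; rcases ih with h | h <;> simp [h]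

theorem abs_levelSign (n : ℕ) : |levelSign n| = 1 := by
  rcases levelSign_cases n with h | h <;> simp [h]

theorem levelSign_sq (n : ℕ) : levelSign n * levelSign n = 1 := by
  rcases levelSign_cases n with h | h <;> simp [h]

theorem two_div_le_levelWeight (n : ℕ) : 2 / (n + 2 : ℝ) ≤ levelWeight n := by
  induction n using forest_induction with
  | h0 => simp
  | h1 => norm_num
  | h2 n ih =>
    rw [levelWeight]
    have h : ((n / 2 : ℕ) : ℝ) ≤ n / 2 := Nat.cast_div_le
    have h1 : 2 / ((n : ℝ) / 2 + 2) ≤ 2 / ((n / 2 : ℕ) + 2 : ℝ) := by gcongr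
    have h2 : 2 / ((n : ℝ) / 2 + 2) = 4 / (n + 4) := by field_simp; ring
    have h3 : 2 / (((n + 2 : ℕ) : ℝ) + 2) = 4 / (n + 4) / 2 := by
      push_cast; field_simp; ring
    rw [h3]
    linarith

theorem log_le_sum_levelWeight (N : ℕ) :
    Real.log (N + 1) ≤ ∑ n ∈ Finset.range N, levelWeight n := by
  induction N with
  | zero => simp
  | succ N ih =>
    rw [Finset.sum_range_succ]
    have h : Real.log ((N + 2) / (N + 1)) ≤ levelWeight N := by
      refine ((Real.log_le_sub_one_of_pos (by positivity)).trans ?_).trans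
        (two_div_le_levelWeight N)
      rw [div_sub_one (by positivity), div_le_div_iff₀ (by positivity) (by positivity)]
      ring_nf
      have : (0 : ℝ) ≤ N := N.cast_nonneg
      linarith
    rw [Real.log_div (by positivity) (by positivity)] at h
    push_cast
    rw [add_assoc, one_add_one_eq_two]
    linarith

theorem sum_levelWeight_double (N : ℕ) :
    ∑ n ∈ Finset.range (2 * N + 2), levelWeight n = ∑ n ∈ Finset.range N, levelWeight n + 2 := by
  induction N with
  | zero => simp [Finset.sum_range_succ]; norm_num
  | succ N ih =>
    rw [show 2 * (N + 1) + 2 = (2 * N + 2) + 1 + 1 by ring, Finset.sum_range_succ,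
      Finset.sum_range_succ, ih, Finset.sum_range_succ, levelWeight_add_two,
      show 2 * N + 2 + 1 = 2 * N + 1 + 2 by ring, levelWeight_add_two,
      show (2 * N + 1) / 2 = N by omega, show 2 * N / 2 = N by omega]
    ring

/-- Truncation of the series for the forest weight after `L` generations. -/
theorem forestWeight_le_sum (k L n : ℕ) :
    forestWeight k n ≤ ∑ d ∈ Finset.range L,
      (if (n + 2) / 2 ^ d = k + 2 then (1 / 2 : ℝ) ^ d else 0) + (1 / 2 : ℝ) ^ L := by
  induction L generalizing n with
  | zero => simpa using forestWeight_le_one k n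
  | succ L ih =>
    rw [Finset.sum_range_succ', pow_zero, Nat.div_one, pow_zero]
    have hroot : ∀ r : ℕ, 0 ≤ ∑ d ∈ Finset.range L,
        (if (r + 2) / 2 ^ (d + 1) = k + 2 then (1 / 2 : ℝ) ^ (d + 1) else 0)
          + (1 / 2 : ℝ) ^ (L + 1) := fun r => by
      refine add_nonneg (Finset.sum_nonneg fun d _ => ?_) (by positivity)
      split_ifs <;> positivity
    match n with
    | 0 =>
      have := hroot 0
      rw [forestWeight_zero]
      simp only [Nat.add_right_cancel_iff]
      linarith
    | 1 =>
      have := hroot 1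
      rw [forestWeight_one]
      simp only [Nat.add_right_cancel_iff]
      linarith
    | n + 2 =>
      have h := ih (n / 2)
      rw [forestWeight_add_two]
      have hd : ∀ d, (n + 2 + 2) / 2 ^ (d + 1) = (n / 2 + 2) / 2 ^ d := fun d => by
        rw [pow_succ', ← Nat.div_div_eq_div_mul]
        congr 1
        omega
      simp only [hd, Nat.add_right_cancel_iff]
      have h2 : (∑ d ∈ Finset.range L,
          (if (n / 2 + 2) / 2 ^ d = k + 2 then (1 / 2 : ℝ) ^ (d + 1) else 0))
          = (∑ d ∈ Finset.range L,
          (if (n / 2 + 2) / 2 ^ d = k + 2 then (1 / 2 : ℝ) ^ d else 0)) / 2 := by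
        rw [Finset.sum_div]
        refine Finset.sum_congr rfl fun d _ => ?_
        split_ifs
        · ring
        · simp
      rw [h2, pow_succ]
      linarith

theorem card_filter_div_le (A : Finset ℕ) (k d : ℕ) :
    (A.filter fun n => (n + 2) / 2 ^ d = k + 2).card ≤ 2 ^ d := by
  have h : ((A.filter fun n => (n + 2) / 2 ^ d = k + 2).map (addRightEmbedding 2)) ⊆
      Finset.Ico ((k + 2) * 2 ^ d) ((k + 2) * 2 ^ d + 2 ^ d) := by
    intro m hm
    simp only [Finset.mem_map, Finset.mem_filter, addRightEmbedding_apply] at hm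
    obtain ⟨n, ⟨-, hn⟩, rfl⟩ := hm
    rw [Finset.mem_Ico, ← hn]
    refine ⟨Nat.div_mul_le_self _ _, ?_⟩
    have := Nat.lt_div_mul_add (a := n + 2) (b := 2 ^ d) (by positivity)
    exact this
  have h2 := Finset.card_le_card h
  simpa using h2

theorem sum_forestWeight_le {A : Finset ℕ} {N : ℕ} (hA : A.card ≤ N) (hN : 1 ≤ N) (k : ℕ) :
    ∑ n ∈ A, forestWeight k n ≤ 6 * Real.log (N + 1) := by
  set L := Nat.log 2 N + 1 with hL
  have h1 : ∑ n ∈ A, forestWeight k n ≤ L + 1 := by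
    refine (Finset.sum_le_sum fun n _ => forestWeight_le_sum k L n).trans ?_
    rw [Finset.sum_add_distrib, Finset.sum_comm]
    gcongr
    · refine (Finset.sum_le_card_nsmul _ _ 1 fun d _ => ?_).trans (by simp)
      rw [← Finset.sum_filter, Finset.sum_const, nsmul_eq_mul]
      calc _ ≤ ((2 ^ d : ℕ) : ℝ) * (1 / 2) ^ d := by
            gcongr
            exact card_filter_div_le A k d
        _ = 1 := by rw [Nat.cast_pow, ← mul_pow]; norm_num
    · rw [Finset.sum_const, nsmul_eq_mul]
      calc _ ≤ ((2 ^ L : ℕ) : ℝ) * (1 / 2) ^ L := by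
            gcongr
            exact hA.trans (Nat.lt_pow_succ_log_self (by norm_num) N).le
        _ = 1 := by rw [Nat.cast_pow, ← mul_pow]; norm_num
  have h2 : Nat.log 2 N * Real.log 2 ≤ Real.log (N + 1) := by
    rw [← Real.log_pow]
    refine Real.log_le_log (by positivity) ?_
    have := Nat.pow_log_le_self 2 (by omega : N ≠ 0)
    have h3 : ((2 ^ Nat.log 2 N : ℕ) : ℝ) ≤ N := by exact_mod_cast this
    push_cast at h3
    linarith
  have h3 : Real.log 2 ≤ Real.log (N + 1) := by
    refine Real.log_le_log (by norm_num) ?_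
    have : (1 : ℝ) ≤ N := by exact_mod_cast hN
    linarith
  have h4 := Real.log_two_gt_d9
  have h5 : (0 : ℝ) ≤ Nat.log 2 N := Nat.cast_nonneg _
  rw [hL] at h1
  push_cast at h1
  nlinarith

theorem sum_range_double_add_two (N : ℕ) (g : ℕ → ℝ) :
    ∑ n ∈ Finset.range (2 * N + 2), g n =
      g 0 + g 1 + ∑ n ∈ Finset.range N, (g (2 * n + 2) + g (2 * n + 3)) := by
  induction N with
  | zero => simp [Finset.sum_range_succ]
  | succ N ih =>
    rw [show 2 * (N + 1) + 2 = (2 * N + 2) + 1 + 1 by ring, Finset.sum_range_succ,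
      Finset.sum_range_succ, ih, Finset.sum_range_succ]
    ring

theorem forestWeight_double (k n : ℕ) :
    forestWeight k (2 * n + 2) = (if 2 * n + 2 = k then 1 else 0) + forestWeight k n / 2 := by
  rw [forestWeight_add_two, show 2 * n / 2 = n by omega]

theorem forestWeight_double' (k n : ℕ) :
    forestWeight k (2 * n + 3) = (if 2 * n + 3 = k then 1 else 0) + forestWeight k n / 2 := by
  rw [show 2 * n + 3 = 2 * n + 1 + 2 by ring, forestWeight_add_two,
    show (2 * n + 1) / 2 = n by omega]

theorem levelSign_double (n : ℕ) : levelSign (2 * n + 2) = -levelSign n := by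
  rw [levelSign_add_two, show 2 * n / 2 = n by omega]

theorem levelSign_double' (n : ℕ) : levelSign (2 * n + 3) = -levelSign n := by
  rw [show 2 * n + 3 = 2 * n + 1 + 2 by ring, levelSign_add_two,
    show (2 * n + 1) / 2 = n by omega]

theorem sum_levelSign_forestWeight_double (k N : ℕ) :
    ∑ n ∈ Finset.range (2 * N + 2), levelSign n * forestWeight k n =
      (if k < 2 * N + 2 then levelSign k else 0) -
        ∑ n ∈ Finset.range N, levelSign n * forestWeight k n := by
  have h : (if k < 2 * N + 2 then levelSign k else 0) =
      ∑ n ∈ Finset.range (2 * N + 2), levelSign n * (if n = k then 1 else 0) := by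
    simp
  rw [h, sum_range_double_add_two, sum_range_double_add_two, add_sub_assoc,
    ← Finset.sum_sub_distrib, forestWeight_zero, forestWeight_one]
  congr 1
  refine Finset.sum_congr rfl fun n _ => ?_
  rw [forestWeight_double, forestWeight_double', levelSign_double, levelSign_double']
  ring

/-- The alternating sums along the levels stay bounded. -/
theorem levelSign_mul_sum_mem_Icc (k N : ℕ) :
    levelSign k * ∑ n ∈ Finset.range N, levelSign n * forestWeight k n ∈ Set.Icc (0 : ℝ) 1 := by
  have hzero : ∀ N ≤ k, ∑ n ∈ Finset.range N, levelSign n * forestWeight k n = 0 := fun N hN =>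
    Finset.sum_eq_zero fun n hn => by
      rw [forestWeight_eq_zero ((Finset.mem_range.1 hn).trans_le hN), mul_zero]
  have heven : ∀ N, levelSign k * ∑ n ∈ Finset.range N, levelSign n * forestWeight k n
      ∈ Set.Icc (0 : ℝ) 1 →
      levelSign k * ∑ n ∈ Finset.range (2 * N + 2), levelSign n * forestWeight k n
      ∈ Set.Icc (0 : ℝ) 1 := fun N h => by
    rw [sum_levelSign_forestWeight_double]
    split_ifs with hk
    · rw [mul_sub, levelSign_sq]
      exact ⟨by linarith [h.2], by linarith [h.1]⟩
    · rw [hzero N (by omega)]; simp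
  induction N using Nat.strong_induction_on with
  | _ N ih =>
    rcases Nat.lt_or_ge k N with hk | hk
    swap
    · rw [hzero N hk]; simp
    obtain ⟨M, rfl | rfl⟩ : ∃ M, N = 2 * M + 2 ∨ N = 2 * M + 1 := ⟨(N - 1) / 2, by omega⟩
    · exact heven M (ih M (by omega))
    · rcases M with _ | M
      · obtain rfl : k = 0 := by omega
        simp [forestWeight_zero]
      · rw [show 2 * (M + 1) + 1 = (2 * M + 2) + 1 by ring] at hk ⊢
        rcases Nat.lt_succ_iff_lt_or_eq.1 hk with hk' | rfl
        · have h1 := heven M (ih M (by omega))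
          have h2 := heven (M + 1) (ih (M + 1) (by omega))
          rw [show 2 * (M + 1) + 2 = (2 * M + 2) + 1 + 1 by ring, Finset.sum_range_succ,
            Finset.sum_range_succ, forestWeight_double, forestWeight_double', levelSign_double,
            levelSign_double', if_neg (by omega), if_neg (by omega)] at h2
          rw [Finset.sum_range_succ, forestWeight_double, levelSign_double, if_neg (by omega)]
          simp only [Set.mem_Icc] at h1 h2 ⊢
          constructor <;> linarith [h1.1, h1.2, h2.1, h2.2]
        · rw [Finset.sum_range_succ, hzero _ le_rfl, forestWeight_self, zero_add, mul_one,
            levelSign_sq]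
          simp

theorem abs_sum_levelSign_forestWeight_le (k N : ℕ) :
    |∑ n ∈ Finset.range N, levelSign n * forestWeight k n| ≤ 1 := by
  have h := levelSign_mul_sum_mem_Icc k N
  rw [← one_mul |_|, ← abs_levelSign k, ← abs_mul, abs_of_nonneg h.1]
  simpa [abs_levelSign] using h.2

/-- If the nodes in `[p, 2p + 2)` carry total forest weight at most one, so do their children. -/
theorem sum_level_forestWeight_double {p : ℕ}
    (h : ∀ k, ∑ n ∈ Finset.Ico p (2 * p + 2), forestWeight k n = if k < 2 * p + 2 then 1 else 0)
    (k : ℕ) : ∑ n ∈ Finset.Ico (2 * p + 2) (2 * (2 * p + 2) + 2), forestWeight k n =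
      if k < 2 * (2 * p + 2) + 2 then 1 else 0 := by
  have key : ∀ g : ℕ → ℝ, ∑ n ∈ Finset.Ico (2 * p + 2) (2 * (2 * p + 2) + 2), g n =
      ∑ n ∈ Finset.Ico p (2 * p + 2), (g (2 * n + 2) + g (2 * n + 3)) := by
    intro g
    rw [Finset.sum_Ico_eq_sub _ (by omega), Finset.sum_Ico_eq_sub _ (by omega),
      sum_range_double_add_two (2 * p + 2) g, sum_range_double_add_two p g]
    ring
  have h3 : ∑ n ∈ Finset.Ico p (2 * p + 2),
      ((if 2 * n + 2 = k then (1 : ℝ) else 0) + if 2 * n + 3 = k then 1 else 0) =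
      ∑ n ∈ Finset.Ico (2 * p + 2) (2 * (2 * p + 2) + 2), if n = k then 1 else 0 :=
    (key fun n => if n = k then 1 else 0).symm
  rw [key]
  simp only [forestWeight_double, forestWeight_double']
  rw [Finset.sum_congr rfl fun n _ => show
    ((if 2 * n + 2 = k then (1 : ℝ) else 0) + forestWeight k n / 2) +
      ((if 2 * n + 3 = k then (1 : ℝ) else 0) + forestWeight k n / 2) =
    ((if 2 * n + 2 = k then (1 : ℝ) else 0) + if 2 * n + 3 = k then 1 else 0) +
      forestWeight k n by ring,
    Finset.sum_add_distrib, h3, h, Finset.sum_ite_eq']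
  simp only [Finset.mem_Ico]
  split_ifs <;> first | omega | norm_num

/-- There are arbitrarily large antichains beyond any node, with total forest weight at most one. -/
theorem exists_antichain (N : ℕ) : ∃ A : Finset ℕ, A.card = N ∧ (∀ n ∈ A, N ≤ n) ∧
    ∀ k, ∑ n ∈ A, forestWeight k n ≤ 1 := by
  obtain ⟨p, hp, h⟩ : ∃ p ≥ N, ∀ k, ∑ n ∈ Finset.Ico p (2 * p + 2), forestWeight k n =
      if k < 2 * p + 2 then 1 else 0 := by
    induction N with
    | zero =>
      refine ⟨0, le_rfl, fun k => ?_⟩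
      simp only [mul_zero, zero_add, Nat.Ico_zero_eq_range]
      norm_num [Finset.sum_range_succ, forestWeight_zero, forestWeight_one]
      rcases k with _ | _ | k <;> simp
    | succ N ih =>
      obtain ⟨p, hp, h⟩ := ih
      exact ⟨2 * p + 2, by omega, sum_level_forestWeight_double h⟩
  refine ⟨Finset.Ico p (p + N), by simp, fun n hn => ?_, fun k => ?_⟩
  · exact hp.trans (Finset.mem_Ico.1 hn).1
  · refine (Finset.sum_le_sum_of_subset_of_nonneg
      (Finset.Ico_subset_Ico_right (by omega : p + N ≤ 2 * p + 2))
      fun n _ _ => forestWeight_nonneg k n).trans ?_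
    rw [h]
    split_ifs <;> norm_num

section Ell1

variable {𝕜 : Type*} [RCLike 𝕜]

theorem sum_norm_apply_le (v : ell1 𝕜) (S : Finset ℕ) : ∑ m ∈ S, ‖v m‖ ≤ ‖v‖ := by
  simpa using lp.sum_rpow_le_norm_rpow (p := 1) (by simp) v S

theorem norm_le_of_sum_norm_apply_le {v : ell1 𝕜} {C : ℝ} (hC : 0 ≤ C)
    (h : ∀ S : Finset ℕ, ∑ m ∈ S, ‖v m‖ ≤ C) : ‖v‖ ≤ C :=
  lp.norm_le_of_forall_sum_le (by simp) hC (by simpa using h)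

theorem unitVec_apply (k n : ℕ) : unitVec 𝕜 k n = if n = k then 1 else 0 := by
  simp [unitVec, Pi.single_apply]

theorem norm_unitVec (k : ℕ) : ‖unitVec 𝕜 k‖ = 1 := by
  rw [unitVec, lp.norm_single (by norm_num)]
  simp

/-- A functional on `ℓ¹` is bounded by its values at the canonical vectors. -/
theorem norm_apply_le_of_unitVec (F : StrongDual 𝕜 (ell1 𝕜)) {M : ℝ}
    (h : ∀ k, ‖F (unitVec 𝕜 k)‖ ≤ M) (v : ell1 𝕜) : ‖F v‖ ≤ M * ‖v‖ := by
  have h1 := (lp.hasSum_single (p := 1) (by norm_num) v).mapL F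
  refine le_of_tendsto h1.norm (Eventually.of_forall fun S => ?_)
  calc ‖∑ k ∈ S, F (lp.single 1 k (v k))‖ ≤ ∑ k ∈ S, ‖F (lp.single 1 k (v k))‖ :=
        norm_sum_le _ _
    _ ≤ ∑ k ∈ S, M * ‖v k‖ := by
        refine Finset.sum_le_sum fun k _ => ?_
        have h2 : lp.single 1 k (v k) = v k • unitVec 𝕜 k := by
          rw [unitVec, ← lp.single_smul, smul_eq_mul, mul_one]
        rw [h2, map_smul, norm_smul, mul_comm]
        gcongr
        exact h k
    _ ≤ M * ‖v‖ := by
        rw [← Finset.mul_sum]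
        exact mul_le_mul_of_nonneg_left (sum_norm_apply_le v S) ((norm_nonneg _).trans (h 0))

theorem lindFun_zero_apply (z : ell1 𝕜) : lindFun 𝕜 0 z = z 0 := by
  rw [lindFun]; rfl

theorem lindFun_one_apply (z : ell1 𝕜) : lindFun 𝕜 1 z = z 1 := by
  rw [lindFun]; rfl

theorem lindFun_add_two_apply (n : ℕ) (z : ell1 𝕜) :
    lindFun 𝕜 (n + 2) z = z (n + 2) + (1 / 2 : 𝕜) * lindFun 𝕜 (n / 2) z := by
  rw [lindFun]; rfl

theorem lindFun_double_apply (n : ℕ) (z : ell1 𝕜) :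
    lindFun 𝕜 (2 * n + 2) z = z (2 * n + 2) + (1 / 2 : 𝕜) * lindFun 𝕜 n z := by
  rw [lindFun_add_two_apply, show 2 * n / 2 = n by omega]

theorem lindFun_double_apply' (n : ℕ) (z : ell1 𝕜) :
    lindFun 𝕜 (2 * n + 3) z = z (2 * n + 3) + (1 / 2 : 𝕜) * lindFun 𝕜 n z := by
  rw [show 2 * n + 3 = 2 * n + 1 + 2 by ring, lindFun_add_two_apply,
    show (2 * n + 1) / 2 = n by omega]

theorem lindFun_unitVec (n k : ℕ) : lindFun 𝕜 n (unitVec 𝕜 k) = (forestWeight k n : 𝕜) := by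
  induction n using forest_induction with
  | h0 =>
    rw [lindFun_zero_apply, unitVec_apply, forestWeight_zero]
    split_ifs <;> simp
  | h1 =>
    rw [lindFun_one_apply, unitVec_apply, forestWeight_one]
    split_ifs <;> simp
  | h2 n ih =>
    rw [lindFun_add_two_apply, ih, unitVec_apply, forestWeight_add_two]
    split_ifs <;> push_cast <;> ring

theorem lindFun_lindVec (n m : ℕ) : lindFun 𝕜 n (lindVec 𝕜 m) = if n = m then 1 else 0 :=
  lindCoord_lindBasis 𝕜 n m

theorem norm_sum_lindFun_apply_le {A : Finset ℕ} {a : ℕ → 𝕜} {M : ℝ}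
    (h : ∀ k, ‖∑ n ∈ A, a n * (forestWeight k n : 𝕜)‖ ≤ M) (v : ell1 𝕜) :
    ‖∑ n ∈ A, a n * lindFun 𝕜 n v‖ ≤ M * ‖v‖ := by
  have h1 := norm_apply_le_of_unitVec (∑ n ∈ A, a n • lindFun 𝕜 n) (M := M)
    (fun k => by simpa [lindFun_unitVec] using h k) v
  simpa using h1

theorem norm_lindFun_le (n : ℕ) : ‖lindFun 𝕜 n‖ ≤ 1 := by
  refine ContinuousLinearMap.opNorm_le_bound _ zero_le_one fun v => ?_
  refine norm_apply_le_of_unitVec _ (fun k => ?_) v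
  rw [lindFun_unitVec, RCLike.norm_ofReal, abs_of_nonneg (forestWeight_nonneg k n)]
  exact forestWeight_le_one k n

theorem norm_half : ‖(1 / 2 : 𝕜)‖ = 1 / 2 := by
  rw [norm_div, norm_one, RCLike.norm_ofNat]

theorem norm_lindVec_le (n : ℕ) : ‖lindVec 𝕜 n‖ ≤ 2 := by
  refine (norm_sub_le _ _).trans ((add_le_add_left (norm_sub_le _ _) _).trans ?_)
  rw [norm_smul, norm_smul, norm_unitVec, norm_unitVec, norm_unitVec, norm_half]
  norm_num

/-- The coefficients `2⁻ᵈ` telescope along the levels. -/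
theorem norm_sum_levelWeight_lindVec_le (N : ℕ) :
    ‖∑ n ∈ Finset.range N, (levelWeight n : 𝕜) • lindVec 𝕜 n‖ ≤ 4 := by
  have hid : ∑ n ∈ Finset.range N, (levelWeight n : 𝕜) • lindVec 𝕜 n =
      unitVec 𝕜 0 + unitVec 𝕜 1 -
        (∑ n ∈ Finset.range (2 * N + 2), (levelWeight n : 𝕜) • unitVec 𝕜 n -
          ∑ n ∈ Finset.range N, (levelWeight n : 𝕜) • unitVec 𝕜 n) := by
    induction N with
    | zero => simp [Finset.sum_range_succ]
    | succ N ih =>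
      rw [show 2 * (N + 1) + 2 = (2 * N + 2) + 1 + 1 by ring, Finset.sum_range_succ, ih,
        Finset.sum_range_succ _ (2 * N + 2 + 1), Finset.sum_range_succ _ (2 * N + 2),
        Finset.sum_range_succ _ N, levelWeight_add_two (2 * N),
        show 2 * N + 2 + 1 = 2 * N + 1 + 2 by ring, levelWeight_add_two (2 * N + 1),
        show (2 * N + 1) / 2 = N by omega, show 2 * N / 2 = N by omega, lindVec,
        show 2 * N + 1 + 2 = 2 * N + 3 by ring]
      push_cast
      module
  rw [hid, ← Finset.sum_Ico_eq_sub _ (by omega : N ≤ 2 * N + 2)]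
  have h1 : ‖∑ n ∈ Finset.Ico N (2 * N + 2), (levelWeight n : 𝕜) • unitVec 𝕜 n‖ ≤ 2 := by
    refine (norm_sum_le _ _).trans (le_of_eq ?_)
    simp only [norm_smul, norm_unitVec, RCLike.norm_ofReal, mul_one,
      abs_of_nonneg (levelWeight_pos _).le]
    rw [Finset.sum_Ico_eq_sub _ (by omega), sum_levelWeight_double]
    ring
  refine (norm_sub_le _ _).trans ((add_le_add (norm_add_le _ _) h1).trans ?_)
  rw [norm_unitVec, norm_unitVec]
  norm_num

/-- Alternating the signs along the levels produces a vector of large norm. -/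
theorem le_norm_sum_levelSign_lindVec (N : ℕ) :
    2 * ∑ n ∈ Finset.range N, levelWeight n ≤
      ‖∑ n ∈ Finset.range N, ((levelSign n * levelWeight n : ℝ) : 𝕜) • lindVec 𝕜 n‖ := by
  set F : StrongDual 𝕜 (ell1 𝕜) :=
    ∑ m ∈ Finset.range (2 * N + 2), (levelSign m : 𝕜) • evalFun 𝕜 m with hF
  have hFapp : ∀ v, F v = ∑ m ∈ Finset.range (2 * N + 2), (levelSign m : 𝕜) * v m := fun v => by
    simp [hF]; rfl
  have hFunit : ∀ k < 2 * N + 2, F (unitVec 𝕜 k) = (levelSign k : 𝕜) := fun k hk => by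
    rw [hFapp]
    simp [unitVec_apply, hk]
  have h1 : F (∑ n ∈ Finset.range N, ((levelSign n * levelWeight n : ℝ) : 𝕜) • lindVec 𝕜 n) =
      ((2 * ∑ n ∈ Finset.range N, levelWeight n : ℝ) : 𝕜) := by
    rw [map_sum, Finset.mul_sum, RCLike.ofReal_sum]
    refine Finset.sum_congr rfl fun n hn => ?_
    have hn' := Finset.mem_range.1 hn
    rw [map_smul, lindVec, map_sub, map_sub, map_smul, map_smul, hFunit _ (by omega),
      hFunit _ (by omega), hFunit _ (by omega), levelSign_double, levelSign_double', smul_eq_mul,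
      smul_eq_mul]
    have h2 : ((levelSign n : ℝ) : 𝕜) * (levelSign n : 𝕜) = 1 := by
      rw [← RCLike.ofReal_mul, levelSign_sq, RCLike.ofReal_one]
    push_cast
    linear_combination (2 * (levelWeight n : 𝕜)) * h2
  have h3 : ‖F (∑ n ∈ Finset.range N, ((levelSign n * levelWeight n : ℝ) : 𝕜) • lindVec 𝕜 n)‖ ≤
      1 * ‖∑ n ∈ Finset.range N, ((levelSign n * levelWeight n : ℝ) : 𝕜) • lindVec 𝕜 n‖ := by
    rw [hFapp, one_mul]
    refine (norm_sum_le _ _).trans (le_trans (le_of_eq ?_)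
      (sum_norm_apply_le _ (Finset.range (2 * N + 2))))
    refine Finset.sum_congr rfl fun m _ => ?_
    rw [norm_mul, RCLike.norm_ofReal, abs_levelSign, one_mul]
  rw [h1, RCLike.norm_ofReal, one_mul] at h3
  exact (le_abs_self _).trans h3

theorem le_norm_sum_lindVec_Ico (N : ℕ) :
    2 * (N : ℝ) ≤ ‖∑ n ∈ Finset.Ico N (2 * N), lindVec 𝕜 n‖ := by
  set ε : ℕ → 𝕜 := fun m => if m < 2 * N then 1 else -1 with hε
  set F : StrongDual 𝕜 (ell1 𝕜) :=
    ∑ m ∈ Finset.range (4 * N + 2), ε m • evalFun 𝕜 m with hF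
  have hFapp : ∀ v, F v = ∑ m ∈ Finset.range (4 * N + 2), ε m * v m := fun v => by
    simp [hF]; rfl
  have hFunit : ∀ k < 4 * N + 2, F (unitVec 𝕜 k) = ε k := fun k hk => by
    rw [hFapp]
    simp [unitVec_apply, hk]
  have h1 : F (∑ n ∈ Finset.Ico N (2 * N), lindVec 𝕜 n) = ((2 * N : ℝ) : 𝕜) := by
    rw [map_sum, Finset.sum_congr rfl fun n hn => show F (lindVec 𝕜 n) = 2 by
      have hn' := Finset.mem_Ico.1 hn
      rw [lindVec, map_sub, map_sub, map_smul, map_smul, hFunit _ (by omega),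
        hFunit _ (by omega), hFunit _ (by omega), hε]
      simp only
      rw [if_pos hn'.2, if_neg (by omega), if_neg (by omega), smul_eq_mul]
      norm_num]
    rw [Finset.sum_const, Nat.card_Ico, nsmul_eq_mul, show 2 * N - N = N by omega]
    push_cast
    ring
  have h3 : ‖F (∑ n ∈ Finset.Ico N (2 * N), lindVec 𝕜 n)‖ ≤
      ‖∑ n ∈ Finset.Ico N (2 * N), lindVec 𝕜 n‖ := by
    rw [hFapp]
    refine (norm_sum_le _ _).trans (le_trans (le_of_eq ?_)
      (sum_norm_apply_le _ (Finset.range (4 * N + 2))))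
    refine Finset.sum_congr rfl fun m _ => ?_
    rw [norm_mul, hε]
    simp only
    split_ifs <;> simp
  rw [h1, RCLike.norm_ofReal] at h3
  exact (le_abs_self _).trans h3

/-! ### Large coefficients -/

theorem abs_min_sub_min_le (a b t : ℝ) : |min a t - min b t| ≤ |a - b| := by
  simpa using abs_min_sub_min_le_max a t b t

theorem sum_truncation_le (z : ell1 𝕜) {t : ℝ} (ht : 0 ≤ t) (R : ℕ) :
    ∑ n ∈ Finset.range R, 2 * min (‖lindFun 𝕜 n z‖ / 2) t -
      ∑ m ∈ Finset.range (2 * R + 2), min ‖lindFun 𝕜 m z‖ t ≤ ‖z‖ := by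
  refine le_trans ?_ (sum_norm_apply_le z (Finset.range (2 * R + 2)))
  rw [sum_range_double_add_two, sum_range_double_add_two, sub_le_iff_le_add]
  have h0 : (0 : ℝ) ≤ ‖z 0‖ + ‖z 1‖ +
      (min ‖lindFun 𝕜 0 z‖ t + min ‖lindFun 𝕜 1 z‖ t) := by positivity
  have key : ∀ (w c d : 𝕜), w = c + 1 / 2 * d → min (‖d‖ / 2) t ≤ ‖c‖ + min ‖w‖ t := by
    intro w c d h
    have h1 := abs_min_sub_min_le (‖d‖ / 2) ‖w‖ t
    have h2 : |‖d‖ / 2 - ‖w‖| ≤ ‖c‖ := by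
      have h3 := abs_norm_sub_norm_le (1 / 2 * d) w
      rw [norm_mul, norm_half] at h3
      rw [show ‖d‖ / 2 = 1 / 2 * ‖d‖ by ring]
      refine h3.trans (le_of_eq ?_)
      rw [h, sub_add_cancel_right, norm_neg]
    linarith [(le_abs_self (min (‖d‖ / 2) t - min ‖w‖ t)).trans (h1.trans h2)]
  have h1 : ∑ n ∈ Finset.range R, 2 * min (‖lindFun 𝕜 n z‖ / 2) t ≤
      ∑ n ∈ Finset.range R, (‖z (2 * n + 2)‖ + ‖z (2 * n + 3)‖) +
      ∑ n ∈ Finset.range R, (min ‖lindFun 𝕜 (2 * n + 2) z‖ t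
        + min ‖lindFun 𝕜 (2 * n + 3) z‖ t) := by
    rw [← Finset.sum_add_distrib]
    refine Finset.sum_le_sum fun n _ => ?_
    have h2 := key _ _ _ (lindFun_double_apply n z)
    have h3 := key _ _ _ (lindFun_double_apply' n z)
    linarith
  linarith

theorem two_mul_min_half_sub_nonneg (b : ℝ) {t : ℝ} (ht : 0 ≤ t) :
    0 ≤ 2 * min (b / 2) t - min b t := by
  rcases le_total (b / 2) t with h | h
  · rw [min_eq_left h]; linarith [min_le_left b t]
  · rw [min_eq_right h]; linarith [min_le_right b t]

theorem exists_lindFun_eq_zero {z : ell1 𝕜} (hz : z ∈ Submodule.span 𝕜 (Set.range (lindVec 𝕜))) :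
    ∃ R, ∀ n ≥ R, lindFun 𝕜 n z = 0 := by
  induction hz using Submodule.span_induction with
  | mem y hy =>
    obtain ⟨m, rfl⟩ := hy
    exact ⟨m + 1, fun n hn => by rw [lindFun_lindVec, if_neg (by omega)]⟩
  | zero => exact ⟨0, by simp⟩
  | add y z _ _ h1 h2 =>
    obtain ⟨R, hR⟩ := h1
    obtain ⟨S, hS⟩ := h2
    exact ⟨max R S, fun n hn => by
      rw [map_add, hR n (le_of_max_le_left hn), hS n (le_of_max_le_right hn), add_zero]⟩
  | smul a y _ h =>
    obtain ⟨R, hR⟩ := h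
    exact ⟨R, fun n hn => by rw [map_smul, hR n hn, smul_zero]⟩

theorem sum_truncation_mem_le {z : ell1 𝕜} (hz : z ∈ lindSpace 𝕜) {t : ℝ} (ht : 0 ≤ t)
    (A : Finset ℕ) :
    ∑ n ∈ A, (2 * min (‖lindFun 𝕜 n z‖ / 2) t - min ‖lindFun 𝕜 n z‖ t) ≤ ‖z‖ := by
  have hcl : IsClosed {z : ell1 𝕜 |
      ∑ n ∈ A, (2 * min (‖lindFun 𝕜 n z‖ / 2) t - min ‖lindFun 𝕜 n z‖ t) ≤ ‖z‖} :=
    isClosed_le (by fun_prop) continuous_norm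
  refine closure_minimal (s := (Submodule.span 𝕜 (Set.range (lindVec 𝕜)) : Set (ell1 𝕜)))
    (fun z hz => ?_) hcl hz
  obtain ⟨R, hR⟩ := exists_lindFun_eq_zero hz
  obtain ⟨S, hS⟩ := A.exists_nat_subset_range
  set M := max R S
  have h1 := sum_truncation_le z ht M
  have h2 : ∑ m ∈ Finset.range (2 * M + 2), min ‖lindFun 𝕜 m z‖ t =
      ∑ m ∈ Finset.range M, min ‖lindFun 𝕜 m z‖ t := by
    refine (Finset.sum_subset (Finset.range_subset_range.2 (by omega)) fun m _ hm => ?_).symm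
    rw [Finset.mem_range, not_lt] at hm
    rw [hR m ((le_max_left _ _).trans hm), norm_zero, min_eq_left ht]
  rw [h2, ← Finset.sum_sub_distrib] at h1
  refine le_trans (Finset.sum_le_sum_of_subset_of_nonneg (hS.trans
    (Finset.range_subset_range.2 (le_max_right _ _))) fun n _ _ => ?_) h1
  exact two_mul_min_half_sub_nonneg _ ht

/-- The weak-type estimate for the coefficients of the Lindenstrauss basis. -/
theorem card_mul_le {z : ell1 𝕜} (hz : z ∈ lindSpace 𝕜) {t : ℝ} {A : Finset ℕ}
    (hA : ∀ n ∈ A, t ≤ ‖lindFun 𝕜 n z‖) : A.card * t ≤ 2 * ‖z‖ := by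
  rcases le_total t 0 with ht | ht
  · nlinarith [norm_nonneg z, (Nat.cast_nonneg A.card : (0 : ℝ) ≤ A.card)]
  · have h := sum_truncation_mem_le hz (div_nonneg ht zero_le_two) A
    rw [Finset.sum_congr rfl fun n hn => show _ = t / 2 by
      rw [min_eq_right (by linarith [hA n hn]), min_eq_right (by linarith [hA n hn])]; ring] at h
    rw [Finset.sum_const, nsmul_eq_mul] at h
    linarith

/-- Greedy projections of the Lindenstrauss basis are bounded. -/
theorem norm_greedy_projection_le {z : ell1 𝕜} (hz : z ∈ lindSpace 𝕜) {A : Finset ℕ}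
    (hA : ∀ n ∈ A, ∀ m ∉ A, ‖lindFun 𝕜 m z‖ ≤ ‖lindFun 𝕜 n z‖) :
    ‖∑ n ∈ A, lindFun 𝕜 n z • lindVec 𝕜 n‖ ≤ 6 * ‖z‖ := by
  rcases A.eq_empty_or_nonempty with rfl | hne
  · simp
  obtain ⟨k, hk, hmin⟩ := Finset.exists_min_image _ (fun n => ‖lindFun 𝕜 n z‖) hne
  set t := ‖lindFun 𝕜 k z‖ with ht
  have hcard := card_mul_le hz hmin
  set v := ∑ n ∈ A, lindFun 𝕜 n z • lindVec 𝕜 n with hv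
  have hcoef : ∀ n, lindFun 𝕜 n v = if n ∈ A then lindFun 𝕜 n z else 0 :=
    coord_sum lindFun_lindVec A _
  have hterm : ∀ m, ‖v m‖ ≤ 2 * ‖z m‖ + if 2 ≤ m ∧ (m - 2) / 2 ∈ A then t else 0 := by
    intro m
    have hroot : ∀ m, lindFun 𝕜 m v = v m → lindFun 𝕜 m z = z m → ‖v m‖ ≤ 2 * ‖z m‖ := by
      intro m h1 h2
      rw [← h1, hcoef, h2]
      split_ifs
      · linarith [norm_nonneg (z m)]
      · simp
    match m with
    | 0 => simpa using hroot 0 (lindFun_zero_apply v) (lindFun_zero_apply z)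
    | 1 => simpa using hroot 1 (lindFun_one_apply v) (lindFun_one_apply z)
    | m + 2 =>
      have h1 := lindFun_add_two_apply m v
      have h2 := lindFun_add_two_apply m z
      have h3 := norm_nonneg (z (m + 2))
      rw [hcoef, hcoef, eq_comm, ← eq_sub_iff_add_eq] at h1
      rw [← sub_eq_iff_eq_add] at h2
      rw [← h2] at h3 ⊢
      rw [h1]
      simp only [le_add_iff_nonneg_left, zero_le, true_and, add_tsub_cancel_right]
      have hhalf : ‖1 / 2 * lindFun 𝕜 (m / 2) z‖ = 1 / 2 * ‖lindFun 𝕜 (m / 2) z‖ := by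
        rw [norm_mul, norm_half]
      have h4 := norm_sub_norm_le (lindFun 𝕜 (m + 2) z) (1 / 2 * lindFun 𝕜 (m / 2) z)
      have h5 := norm_sub_norm_le (1 / 2 * lindFun 𝕜 (m / 2) z) (lindFun 𝕜 (m + 2) z)
      rw [norm_sub_rev] at h5
      rw [hhalf] at h4 h5
      have ht0 : 0 ≤ t := norm_nonneg _
      split_ifs with h6 h7 h7
      · linarith
      · rw [mul_zero, sub_zero]
        have := hA _ h6 _ h7
        linarith
      · rw [zero_sub, norm_neg, hhalf]
        have := hA k hk _ h6
        linarith
      · simp only [mul_zero, sub_zero, norm_zero]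
        linarith
  refine norm_le_of_sum_norm_apply_le (by positivity) fun S => ?_
  have hcount : (S.filter fun m => 2 ≤ m ∧ (m - 2) / 2 ∈ A).card ≤ 2 * A.card := by
    have hsub : (S.filter fun m => 2 ≤ m ∧ (m - 2) / 2 ∈ A) ⊆
        A.image (fun n => 2 * n + 2) ∪ A.image (fun n => 2 * n + 3) := by
      intro m hm
      simp only [Finset.mem_filter, Finset.mem_union, Finset.mem_image] at hm ⊢
      rcases Nat.even_or_odd' (m - 2) with ⟨c, hc | hc⟩
      · exact Or.inl ⟨_, hm.2.2, by omega⟩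
      · exact Or.inr ⟨_, hm.2.2, by omega⟩
    have h1 := Finset.card_le_card hsub
    have h2 := Finset.card_union_le (A.image (fun n => 2 * n + 2)) (A.image (fun n => 2 * n + 3))
    have h3 := Finset.card_image_le (s := A) (f := fun n => 2 * n + 2)
    have h4 := Finset.card_image_le (s := A) (f := fun n => 2 * n + 3)
    omega
  calc ∑ m ∈ S, ‖v m‖ ≤ ∑ m ∈ S, (2 * ‖z m‖ + if 2 ≤ m ∧ (m - 2) / 2 ∈ A then t else 0) :=
        Finset.sum_le_sum fun m _ => hterm m
    _ = 2 * ∑ m ∈ S, ‖z m‖ + (S.filter fun m => 2 ≤ m ∧ (m - 2) / 2 ∈ A).card * t := by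
        rw [Finset.sum_add_distrib, Finset.mul_sum, ← Finset.sum_filter, Finset.sum_const,
          nsmul_eq_mul]
    _ ≤ 2 * ‖z‖ + ((2 * A.card : ℕ) : ℝ) * t := by
        gcongr
        exact sum_norm_apply_le z S
    _ ≤ 6 * ‖z‖ := by push_cast; linarith

end Ell1

section Lindenstrauss

variable {𝕜 : Type*} [RCLike 𝕜] {N : ℕ}

theorem half_le_log (hN : 1 ≤ N) : 1 / 2 ≤ Real.log (N + 1) := by
  have h1 : Real.log 2 ≤ Real.log (N + 1) := by
    refine Real.log_le_log (by norm_num) ?_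
    have : (1 : ℝ) ≤ N := by exact_mod_cast hN
    linarith
  linarith [Real.log_two_gt_d9]

theorem log_double_le (N : ℕ) : Real.log ((2 * N : ℕ) + 1) ≤ 2 * Real.log (N + 1) := by
  have h : Real.log (((N : ℝ) + 1) ^ 2) = 2 * Real.log (N + 1) := by
    rw [Real.log_pow]; norm_num
  rw [← h]
  refine Real.log_le_log (by positivity) ?_
  push_cast
  nlinarith [sq_nonneg (N : ℝ)]

theorem exists_subset_norm_le {X : Type*} [NormedAddCommGroup X] [NormedSpace 𝕜 X] (v : ℕ → X)
    (N : ℕ) : ∃ B ⊆ Finset.range N,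
      ‖∑ n ∈ Finset.range N, (levelSign n : 𝕜) • v n‖ ≤ 2 * ‖∑ n ∈ B, v n‖ := by
  set E := (Finset.range N).filter fun n => levelSign n = 1
  set O := (Finset.range N).filter fun n => ¬ levelSign n = 1
  have h : ∑ n ∈ Finset.range N, (levelSign n : 𝕜) • v n = ∑ n ∈ E, v n - ∑ n ∈ O, v n := by
    rw [← Finset.sum_filter_add_sum_filter_not _ (fun n => levelSign n = 1), sub_eq_add_neg,
      ← Finset.sum_neg_distrib]
    congr 1
    · refine Finset.sum_congr rfl fun n hn => ?_
      rw [(Finset.mem_filter.1 hn).2, RCLike.ofReal_one, one_smul]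
    · refine Finset.sum_congr rfl fun n hn => ?_
      rw [(levelSign_cases n).resolve_left (Finset.mem_filter.1 hn).2, RCLike.ofReal_neg,
        RCLike.ofReal_one, neg_smul, one_smul]
  have h1 := norm_sub_le (∑ n ∈ E, v n) (∑ n ∈ O, v n)
  rw [← h] at h1
  rcases le_total ‖∑ n ∈ E, v n‖ ‖∑ n ∈ O, v n‖ with h2 | h2
  · exact ⟨O, Finset.filter_subset _ _, by linarith⟩
  · exact ⟨E, Finset.filter_subset _ _, by linarith⟩

/-! ### Systems dual to a system on the binary forest -/

section DualForestSystem

variable {Y : Type*} [NormedAddCommGroup Y] [NormedSpace 𝕜 Y]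

/-- The estimates which the constants of the dual of the Lindenstrauss basis depend on. -/
structure DualForestSystem (v : ℕ → Y) (w : ℕ → StrongDual 𝕜 Y) : Prop where
  biorthogonal : ∀ n m, w n (v m) = if n = m then 1 else 0
  tendsto_coord : ∀ φ, Tendsto (fun n => w n φ) atTop (𝓝 0)
  norm_coord_le : ∀ φ n, ‖w n φ‖ ≤ 2 * ‖φ‖
  norm_sum_le : ∀ (A : Finset ℕ) (a : ℕ → 𝕜) (M : ℝ),
    (∀ k, ‖∑ n ∈ A, a n * (forestWeight k n : 𝕜)‖ ≤ M) → ‖∑ n ∈ A, a n • v n‖ ≤ M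
  le_norm_sum_range : ∀ N : ℕ, 1 / 4 * Real.log (N + 1) ≤ ‖∑ n ∈ Finset.range N, v n‖
  norm_proj_le : ∀ {N : ℕ} {A : Finset ℕ}, A.card ≤ N → 1 ≤ N →
    ‖proj v w A‖ ≤ 12 * Real.log (N + 1)

namespace DualForestSystem

variable {v : ℕ → Y} {w : ℕ → StrongDual 𝕜 Y}

theorem norm_sum_le_mul (h : DualForestSystem v w) {A : Finset ℕ} {a : ℕ → 𝕜} {t M : ℝ}
    (ht : 0 ≤ t) (ha : ∀ n ∈ A, ‖a n‖ ≤ t) (hM : ∀ k, ∑ n ∈ A, forestWeight k n ≤ M) :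
    ‖∑ n ∈ A, a n • v n‖ ≤ t * M := by
  refine h.norm_sum_le _ _ _ fun k => ?_
  refine (_root_.norm_sum_le _ _).trans (le_trans ?_ (mul_le_mul_of_nonneg_left (hM k) ht))
  rw [Finset.mul_sum]
  refine Finset.sum_le_sum fun n hn => ?_
  rw [norm_mul, RCLike.norm_ofReal, abs_of_nonneg (forestWeight_nonneg k n)]
  exact mul_le_mul_of_nonneg_right (ha n hn) (forestWeight_nonneg k n)

theorem dominationBound (h : DualForestSystem v w) (hN : 1 ≤ N) :
    DominationBound v w N
      (12 * Real.log (N + 1)) := by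
  intro φ ψ E F t hFN hFE hF hE
  have hl := half_le_log hN
  rw [proj_apply]
  rcases F.eq_empty_or_nonempty with rfl | ⟨k, hk⟩
  · rw [Finset.sum_empty, norm_zero]
    positivity
  have ht : 0 ≤ t := (norm_nonneg _).trans (hF k hk)
  obtain ⟨m, hm⟩ : E.Nonempty :=
    Finset.card_pos.1 ((Finset.card_pos.2 ⟨k, hk⟩).trans_le hFE)
  have h1 := (hE m hm).trans (h.norm_coord_le ψ m)
  refine (h.norm_sum_le_mul ht hF fun k => sum_forestWeight_le hFN hN k).trans ?_
  have := mul_le_mul_of_nonneg_right h1 (by linarith : 0 ≤ 6 * Real.log (N + 1))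
  linarith

theorem lebesgue_le (h : DualForestSystem v w) (hN : 1 ≤ N) : lebesgue v w N ≤
    ENNReal.ofReal (38 * Real.log (N + 1)) := by
  have hl := half_le_log hN
  refine ((h.dominationBound hN).lebesgue_le (K := 24 * Real.log (N + 1)) h.biorthogonal
    (fun A hA => (h.norm_proj_le hA (by omega)).trans (by linarith [log_double_le N])) (by linarith)
    (by linarith)).trans (ENNReal.ofReal_le_ofReal (by linarith))

theorem le_expLebesgue (h : DualForestSystem v w) : ENNReal.ofReal (1 / 4 * Real.log (N + 1)) ≤
    expLebesgue v w N := by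
  obtain ⟨A, hA, hAN, hw⟩ := exists_antichain N
  have hdisj : Disjoint (Finset.range N) A := Finset.disjoint_left.2 fun n hn hn' =>
    absurd (hAN n hn') (not_le.2 (Finset.mem_range.1 hn))
  set φ := ∑ n ∈ Finset.range N ∪ A, (1 : 𝕜) • v n with hφ
  have hsplit : φ = ∑ n ∈ Finset.range N, (1 : 𝕜) • v n +
      ∑ n ∈ A, (1 : 𝕜) • v n := by
    rw [hφ, Finset.sum_union hdisj]
  have hgreedy : IsGreedySet w φ N A := by
    refine ⟨hA, fun n hn m _ => ?_⟩
    rw [hφ, coord_sum h.biorthogonal, coord_sum h.biorthogonal,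
      if_pos (Finset.mem_union_right _ hn)]
    split_ifs <;> simp
  refine ofReal_le_expLebesgue (s := 1) h.tendsto_coord hgreedy (Finset.card_range N).le
    ?_ one_pos ?_
  · rw [hφ, proj_sum h.biorthogonal, Finset.inter_eq_left.2 Finset.subset_union_right, ← hφ,
      hsplit, add_sub_cancel_right, mul_one]
    simpa using h.le_norm_sum_range N
  · rw [hφ, proj_sum h.biorthogonal, Finset.inter_eq_left.2 Finset.subset_union_left, ← hφ,
      hsplit, add_sub_cancel_left]
    simpa using h.norm_sum_le_mul (a := fun _ => 1) zero_le_one (by simp) hw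

theorem le_quasiGreedy (h : DualForestSystem v w) (hN : 1 ≤ N) :
    ENNReal.ofReal (1 / 8 * Real.log (N + 1)) ≤ quasiGreedy v w N := by
  have hl := half_le_log hN
  obtain ⟨B, hB, hle⟩ := exists_subset_norm_le (𝕜 := 𝕜)
    (fun n => (levelSign n : 𝕜) • v n) N
  have hsq : ∀ n, (levelSign n : 𝕜) * (levelSign n : 𝕜) = 1 := fun n => by
    rw [← RCLike.ofReal_mul, levelSign_sq, RCLike.ofReal_one]
  simp only [smul_smul, hsq, one_smul] at hle
  have h1 := (h.le_norm_sum_range N).trans hle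
  set φ := ∑ n ∈ Finset.range N, (levelSign n : 𝕜) • v n with hφ
  have hφ1 : ‖φ‖ ≤ 1 := h.norm_sum_le _ _ _ fun k => by
    have h2 := abs_sum_levelSign_forestWeight_le k N
    rw [← RCLike.norm_ofReal (K := 𝕜)] at h2
    push_cast at h2
    exact h2
  have hproj : proj v w B φ =
      ∑ n ∈ B, (levelSign n : 𝕜) • v n := by
    rw [hφ, proj_sum h.biorthogonal, Finset.inter_eq_left.2 hB]
  refine ofReal_le_quasiGreedy (x := φ) (A := B) (n := B.card) h.tendsto_coord
    ((Finset.card_le_card hB).trans (by simp)) ?_ ⟨rfl, fun n hn m _ => ?_⟩ ?_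
  · intro h0
    rw [h0, map_zero] at hproj
    rw [← hproj, norm_zero] at h1
    linarith
  · rw [hφ, coord_sum h.biorthogonal, coord_sum h.biorthogonal, if_pos (hB hn)]
    split_ifs <;> simp [abs_levelSign]
  · rw [hproj]
    nlinarith

theorem upperDem_le (h : DualForestSystem v w) (hN : 1 ≤ N) : upperDem 𝕜 v N ≤
    ENNReal.ofReal (6 * Real.log (N + 1)) :=
  Greedy.upperDem_le fun A ε hA hε => by
    simpa [signedSum] using h.norm_sum_le_mul (a := ε) zero_le_one (fun n _ => (hε n).le)
      fun k => sum_forestWeight_le hA.le hN k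

theorem upperDem_ne_top (h : DualForestSystem v w) (N : ℕ) : upperDem 𝕜 v N ≠ ⊤ := by
  rcases Nat.eq_zero_or_pos N with rfl | hN
  · refine ne_top_of_le_ne_top ENNReal.ofReal_ne_top
      (Greedy.upperDem_le (C := 0) fun A ε hA _ => ?_)
    rw [Finset.card_eq_zero.1 hA]
    simp [signedSum]
  · exact ne_top_of_le_ne_top ENNReal.ofReal_ne_top (h.upperDem_le hN)

theorem le_upperDem (h : DualForestSystem v w) (N : ℕ) :
    ENNReal.ofReal (1 / 4 * Real.log (N + 1)) ≤ upperDem 𝕜 v N :=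
  ofReal_le_upperDem (Finset.card_range N) (h.le_norm_sum_range N)

theorem lowerDem_le (h : DualForestSystem v w) (N : ℕ) : lowerDem 𝕜 v N ≤ 1 := by
  obtain ⟨A, hA, -, hw⟩ := exists_antichain N
  rw [← ENNReal.ofReal_one]
  refine Greedy.lowerDem_le hA ?_
  simpa using h.norm_sum_le_mul (a := fun _ => 1) zero_le_one (by simp) hw

theorem half_le_lowerDem (h : DualForestSystem v w) (hN : 1 ≤ N) :
    ENNReal.ofReal (1 / 2) ≤ lowerDem 𝕜 v N := by
  refine ofReal_le_lowerDem fun A ε hA hε => ?_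
  obtain ⟨n, hn⟩ := Finset.card_pos.1 (hA ▸ hN)
  have h1 := h.norm_coord_le (signedSum v ε A) n
  rw [signedSum, coord_sum h.biorthogonal, if_pos hn, hε] at h1
  rw [signedSum]
  linarith

theorem superDem_le (h : DualForestSystem v w) (N : ℕ) : superDem 𝕜 v N ≤
    ENNReal.ofReal (12 * Real.log (N + 1)) := by
  refine iSup_le fun n => iSup₂_le fun hn hnN => ?_
  calc _ ≤ ENNReal.ofReal (6 * Real.log (n + 1)) / ENNReal.ofReal (1 / 2) :=
        ENNReal.div_le_div (h.upperDem_le hn) (h.half_le_lowerDem hn)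
    _ = ENNReal.ofReal (12 * Real.log (n + 1)) := by
        rw [← ENNReal.ofReal_div_of_pos (by norm_num)]
        congr 1
        ring
    _ ≤ ENNReal.ofReal (12 * Real.log (N + 1)) := by gcongr

theorem le_superDem (h : DualForestSystem v w) (hN : 1 ≤ N) :
    ENNReal.ofReal (1 / 4 * Real.log (N + 1)) ≤ superDem 𝕜 v N := by
  refine le_trans ?_ (le_iSup_of_le N (le_iSup₂_of_le hN le_rfl le_rfl))
  calc _ ≤ upperDem 𝕜 v N / 1 := by rw [div_one]; exact h.le_upperDem N
    _ ≤ _ := ENNReal.div_le_div_left (h.lowerDem_le N) _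

end DualForestSystem

end DualForestSystem

/-! ### Systems with the estimates of the binary forest -/

section ForestSystem

variable {X : Type*} [NormedAddCommGroup X] [NormedSpace 𝕜 X]

/-- The estimates for the Lindenstrauss basis on which its constants depend. -/
structure ForestSystem (e : ℕ → X) (f : ℕ → StrongDual 𝕜 X) : Prop where
  biorthogonal : ∀ n m, f n (e m) = if n = m then 1 else 0
  norm_le : ∀ n, ‖e n‖ ≤ 2
  norm_sum_apply_le : ∀ (A : Finset ℕ) (a : ℕ → 𝕜) (M : ℝ),
    (∀ k, ‖∑ n ∈ A, a n * (forestWeight k n : 𝕜)‖ ≤ M) → ∀ x, ‖∑ n ∈ A, a n * f n x‖ ≤ M * ‖x‖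
  norm_sum_levelWeight_le : ∀ N : ℕ, ‖∑ n ∈ Finset.range N, (levelWeight n : 𝕜) • e n‖ ≤ 4

namespace ForestSystem

variable {e : ℕ → X} {f : ℕ → StrongDual 𝕜 X}

theorem norm_sum_le (h : ForestSystem e f) (A : Finset ℕ) (a : ℕ → 𝕜) :
    ‖∑ n ∈ A, a n • e n‖ ≤ 2 * ∑ n ∈ A, ‖a n‖ := by
  rw [Finset.mul_sum]
  refine (_root_.norm_sum_le _ _).trans (Finset.sum_le_sum fun n _ => ?_)
  rw [norm_smul, mul_comm]
  gcongr
  exact h.norm_le n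

theorem sum_norm_apply_le (h : ForestSystem e f) {A : Finset ℕ} (hA : A.card ≤ N) (hN : 1 ≤ N)
    (z : X) : ∑ n ∈ A, ‖f n z‖ ≤ 6 * Real.log (N + 1) * ‖z‖ := by
  have hφ : ∀ w : 𝕜, ∃ θ : 𝕜, ‖θ‖ ≤ 1 ∧ θ * w = (‖w‖ : 𝕜) := fun w => by
    by_cases hw : w = 0
    · exact ⟨0, by simp, by simp [hw]⟩
    · refine ⟨(‖w‖ : 𝕜) / w, ?_, div_mul_cancel₀ _ hw⟩
      rw [norm_div, RCLike.norm_ofReal, abs_norm, div_self (norm_ne_zero_iff.2 hw)]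
  choose θ hθ1 hθ2 using hφ
  have h := h.norm_sum_apply_le A (fun n => θ (f n z)) (6 * Real.log (N + 1)) (fun k => by
      refine (_root_.norm_sum_le _ _).trans (le_trans ?_ (sum_forestWeight_le hA hN k))
      refine Finset.sum_le_sum fun n _ => ?_
      rw [norm_mul, RCLike.norm_ofReal, abs_of_nonneg (forestWeight_nonneg k n)]
      exact mul_le_of_le_one_left (forestWeight_nonneg k n) (hθ1 _)) z
  simp only [hθ2] at h
  rw [← RCLike.ofReal_sum, RCLike.norm_ofReal, abs_of_nonneg
    (Finset.sum_nonneg fun n _ => norm_nonneg _)] at h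
  exact h

theorem norm_proj_le (h : ForestSystem e f) {A : Finset ℕ} (hA : A.card ≤ N) (hN : 1 ≤ N) :
    ‖proj e f A‖ ≤ 12 * Real.log (N + 1) := by
  have hl := half_le_log hN
  refine ContinuousLinearMap.opNorm_le_bound _ (by linarith) fun x => ?_
  have h1 := h.sum_norm_apply_le hA hN x
  rw [proj_apply]
  linarith [h.norm_sum_le A fun n => f n x]

theorem norm_proj_double_le (h : ForestSystem e f) {A : Finset ℕ} (hA : A.card ≤ 2 * N)
    (hN : 1 ≤ N) : ‖proj e f A‖ ≤ 24 * Real.log (N + 1) :=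
  (h.norm_proj_le hA (by omega)).trans (by linarith [log_double_le N])

theorem sum_dualVec_apply (A : Finset ℕ) (a : ℕ → 𝕜) (x : X) :
    ((∑ n ∈ A, a n • dualVec f n : dualSpan f) : StrongDual 𝕜 X) x = ∑ n ∈ A, a n * f n x := by
  rw [AddSubmonoidClass.coe_finsetSum, _root_.sum_apply]
  rfl

theorem norm_sum_dualVec_le (h : ForestSystem e f) {A : Finset ℕ} {a : ℕ → 𝕜} {M : ℝ}
    (hM : ∀ k, ‖∑ n ∈ A, a n * (forestWeight k n : 𝕜)‖ ≤ M) :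
    ‖∑ n ∈ A, a n • dualVec f n‖ ≤ M := by
  refine ContinuousLinearMap.opNorm_le_bound _ ((norm_nonneg _).trans (hM 0)) fun x => ?_
  refine le_trans (le_of_eq (congrArg _ (sum_dualVec_apply A a x))) ?_
  exact h.norm_sum_apply_le A a M hM x

theorem le_norm_sum_dualVec_range (h : ForestSystem e f) (N : ℕ) :
    1 / 4 * Real.log (N + 1) ≤ ‖∑ n ∈ Finset.range N, dualVec f n‖ := by
  set φ := ∑ n ∈ Finset.range N, dualVec f n with hφ
  set z := ∑ n ∈ Finset.range N, (levelWeight n : 𝕜) • e n with hz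
  have h1 : (φ : StrongDual 𝕜 X) z = ((∑ n ∈ Finset.range N, levelWeight n : ℝ) : 𝕜) := by
    have h2 := sum_dualVec_apply (f := f) (Finset.range N) (fun _ => (1 : 𝕜)) z
    simp only [one_smul, one_mul] at h2
    rw [hφ, h2, RCLike.ofReal_sum]
    refine Finset.sum_congr rfl fun n hn => ?_
    rw [hz, coord_sum h.biorthogonal, if_pos hn]
  have h3 := (φ : StrongDual 𝕜 X).le_opNorm z
  rw [h1, RCLike.norm_ofReal] at h3
  have h4 : ‖z‖ ≤ 4 := h.norm_sum_levelWeight_le N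
  have h5 : ‖(φ : StrongDual 𝕜 X)‖ = ‖φ‖ := rfl
  rw [h5] at h3
  have h6 := mul_le_mul_of_nonneg_left h4 (norm_nonneg φ)
  linarith [le_abs_self (∑ n ∈ Finset.range N, levelWeight n), log_le_sum_levelWeight N]

theorem norm_dualFun_apply_le (h : ForestSystem e f) (φ : dualSpan f) (n : ℕ) :
    ‖dualFun e f n φ‖ ≤ 2 * ‖φ‖ := by
  have h1 := (φ : StrongDual 𝕜 X).le_opNorm (e n)
  refine h1.trans ?_
  rw [mul_comm]
  exact mul_le_mul_of_nonneg_right (h.norm_le n) (norm_nonneg (φ : StrongDual 𝕜 X))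

theorem dual (h : ForestSystem e f) :
    DualForestSystem (𝕜 := 𝕜) (dualVec f) (dualFun e f) where
  biorthogonal := dualFun_dualVec h.biorthogonal
  tendsto_coord := tendsto_dualFun h.biorthogonal h.norm_le
  norm_coord_le := h.norm_dualFun_apply_le
  norm_sum_le _ _ _ hM := h.norm_sum_dualVec_le hM
  le_norm_sum_range := h.le_norm_sum_dualVec_range
  norm_proj_le hA hN := (norm_proj_dual_le _).trans (h.norm_proj_le hA hN)

theorem comparable_lebesgueDual (h : ForestSystem e f) :
    Comparable (lebesgueDual e f) logSucc :=
  comparable_logSucc (c := 1 / 4) (C := 38) (by norm_num) (by norm_num)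
    (fun _ _ => h.dual.le_expLebesgue.trans expLebesgue_le_lebesgue)
    fun _ hN => h.dual.lebesgue_le hN

theorem comparable_expLebesgueDual (h : ForestSystem e f) :
    Comparable (expLebesgueDual e f) logSucc :=
  comparable_logSucc (c := 1 / 4) (C := 38) (by norm_num) (by norm_num)
    (fun _ _ => h.dual.le_expLebesgue)
    fun _ hN => expLebesgue_le_lebesgue.trans (h.dual.lebesgue_le hN)

theorem comparable_quasiGreedyDual (h : ForestSystem e f) :
    Comparable (quasiGreedyDual e f) logSucc :=
  comparable_logSucc (c := 1 / 8) (C := 12) (by norm_num) (by norm_num)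
    (fun _ hN => h.dual.le_quasiGreedy hN)
    fun _ hN => quasiGreedy_le (fun _ hA => h.dual.norm_proj_le hA hN)
      (by linarith [half_le_log hN])

theorem comparable_superDemDual (h : ForestSystem e f) :
    Comparable (superDemDual f) logSucc :=
  comparable_logSucc (c := 1 / 4) (C := 12) (by norm_num) (by norm_num)
    (fun _ hN => h.dual.le_superDem hN) fun N _ => h.dual.superDem_le N

theorem upperDemDual_ne_top (h : ForestSystem e f) (N : ℕ) : upperDemDual f N ≠ ⊤ :=
  h.dual.upperDem_ne_top N

theorem upperDemDual_le (h : ForestSystem e f) (hN : 1 ≤ N) :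
    upperDemDual f N ≤ ENNReal.ofReal (6 * Real.log (N + 1)) :=
  h.dual.upperDem_le hN

theorem le_upperDemDual (h : ForestSystem e f) (N : ℕ) :
    ENNReal.ofReal (1 / 4 * Real.log (N + 1)) ≤ upperDemDual f N :=
  h.dual.le_upperDem N

theorem le_condConst (h : ForestSystem e f) (hN : 1 ≤ N) {B : Finset ℕ}
    (hB : B ⊆ Finset.range N)
    (hle : Real.log (N + 1) ≤ ‖∑ n ∈ B, (levelWeight n : 𝕜) • e n‖) :
    ENNReal.ofReal (1 / 4 * Real.log (N + 1)) ≤ condConst e f N := by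
  have hl := half_le_log hN
  set z := ∑ n ∈ Finset.range N, (levelWeight n : 𝕜) • e n with hz
  have hproj : proj e f B z =
      ∑ n ∈ B, (levelWeight n : 𝕜) • e n := by
    rw [hz, proj_sum h.biorthogonal, Finset.inter_eq_left.2 hB]
  have hz4 : ‖z‖ ≤ 4 := h.norm_sum_levelWeight_le N
  refine ofReal_le_condConst ((Finset.card_le_card hB).trans (by simp)) (x := z) ?_ ?_
  · intro h0
    rw [h0, map_zero] at hproj
    rw [← hproj, norm_zero] at hle
    linarith
  · rw [hproj]
    nlinarith

theorem le_lebesgue (h : ForestSystem e f)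
    (hf : ∀ x, Tendsto (fun n => f n x) atTop (𝓝 0)) {B : Finset ℕ} (hB : B ⊆ Finset.range N)
    (hle : Real.log (N + 1) ≤ ‖∑ n ∈ B, (levelWeight n : 𝕜) • e n‖) :
    ENNReal.ofReal (1 / 4 * Real.log (N + 1)) ≤ lebesgue e f N := by
  have hBN : B ⊆ Finset.range (N + B.card) :=
    hB.trans (Finset.range_subset_range.2 (by omega))
  set a : ℕ → 𝕜 := fun n => if n ∈ B then (levelWeight n : 𝕜) else 1 with ha
  set A := Finset.range (N + B.card) \ B with hA
  have hAcard : A.card = N := by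
    rw [hA, Finset.card_sdiff_of_subset hBN, Finset.card_range]
    omega
  set x := ∑ n ∈ Finset.range (N + B.card), a n • e n with hx
  have hsplit : x = ∑ n ∈ A, a n • e n +
      ∑ n ∈ B, (levelWeight n : 𝕜) • e n := by
    rw [hx, ← Finset.sum_sdiff hBN]
    congr 1
    exact Finset.sum_congr rfl fun n hn => by rw [ha]; simp only; rw [if_pos hn]
  have hgreedy : IsGreedySet f x N A := by
    refine ⟨hAcard, fun n hn m _ => ?_⟩
    obtain ⟨hn1, hn2⟩ := Finset.mem_sdiff.1 hn
    rw [hx, coord_sum h.biorthogonal, coord_sum h.biorthogonal, if_pos hn1, ha]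
    simp only
    rw [if_neg hn2, norm_one]
    split_ifs
    · rw [RCLike.norm_ofReal, abs_of_pos (levelWeight_pos m)]
      exact levelWeight_le_one m
    · simp
    · simp
  refine ofReal_le_lebesgue (s := 4) hf hgreedy hAcard.le
    (fun n => 1 - if n < N then (levelWeight n : 𝕜) else 0) ?_ (by norm_num) ?_
  · rw [hx, proj_sum h.biorthogonal, Finset.inter_eq_left.2 Finset.sdiff_subset, ← hx,
      hsplit, add_sub_cancel_left]
    linarith
  · refine le_trans (le_of_eq (congrArg _ ?_)) (h.norm_sum_levelWeight_le N)
    have h1 : ∑ n ∈ Finset.range N, (levelWeight n : 𝕜) • e n =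
        ∑ n ∈ Finset.range (N + B.card),
          (if n < N then (levelWeight n : 𝕜) else 0) • e n := by
      simp only [ite_smul, zero_smul]
      rw [← Finset.sum_filter]
      refine Finset.sum_congr (Finset.ext fun n => ?_) fun _ _ => rfl
      simp only [Finset.mem_filter, Finset.mem_range]
      omega
    rw [h1, ← Finset.sum_sdiff hBN, hsplit, ← hA, add_sub_right_comm, ← Finset.sum_sub_distrib]
    congr 1
    · refine Finset.sum_congr rfl fun n hn => ?_
      rw [ha]
      simp only
      rw [if_neg (Finset.mem_sdiff.1 hn).2, ← sub_smul, sub_sub_cancel]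
    · refine Finset.sum_congr rfl fun n hn => ?_
      rw [if_pos (Finset.mem_range.1 (hB hn))]

theorem one_le_expLebesgue (h : ForestSystem e f)
    (hf : ∀ x, Tendsto (fun n => f n x) atTop (𝓝 0)) (N : ℕ) : 1 ≤ expLebesgue e f N := by
  set x := ∑ n ∈ Finset.range (N + 1), (1 : 𝕜) • e n with hx
  have hgreedy : IsGreedySet f x N (Finset.range N) := by
    refine ⟨Finset.card_range N, fun n hn m _ => ?_⟩
    rw [Finset.mem_range] at hn
    rw [hx, coord_sum h.biorthogonal, coord_sum h.biorthogonal,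
      if_pos (c := n ∈ _) (Finset.mem_range.2 (by omega))]
    split_ifs <;> simp
  have h1 : x - proj e f (Finset.range N) x = e N := by
    rw [hx, proj_sum h.biorthogonal,
      Finset.inter_eq_left.2 (Finset.range_subset_range.2 (by omega)), Finset.sum_range_succ,
      add_sub_cancel_left, one_smul]
  have h2 : e N ≠ 0 := fun h0 => by
    have := h.biorthogonal N N
    rw [h0] at this
    simp at this
  rw [← ENNReal.ofReal_one]
  refine ofReal_le_expLebesgue hf hgreedy (Finset.card_range N).le
    (s := ‖e N‖) ?_ (norm_pos_iff.2 h2) ?_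
  · rw [h1, one_mul]
  · rw [h1]

end ForestSystem

end ForestSystem

/-! ### The Lindenstrauss basis -/

theorem coe_sum_lindBasis (A : Finset ℕ) (a : ℕ → 𝕜) :
    ((∑ n ∈ A, a n • lindBasis 𝕜 n : lindSpace 𝕜) : ell1 𝕜) = ∑ n ∈ A, a n • lindVec 𝕜 n := by
  rw [AddSubmonoidClass.coe_finsetSum]; rfl

theorem norm_sum_lindBasis (A : Finset ℕ) (a : ℕ → 𝕜) :
    ‖∑ n ∈ A, a n • lindBasis 𝕜 n‖ = ‖∑ n ∈ A, a n • lindVec 𝕜 n‖ := by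
  rw [← coe_sum_lindBasis]; rfl

theorem tendsto_lindCoord (x : lindSpace 𝕜) :
    Tendsto (fun n => lindCoord 𝕜 n x) atTop (𝓝 0) := by
  refine tendsto_zero_of_mem_closure_span (𝕜 := 𝕜) (f := lindFun 𝕜) norm_lindFun_le
    (fun m => ?_) x.2
  refine tendsto_const_nhds.congr' ?_
  filter_upwards [eventually_gt_atTop m] with n hn
  rw [lindFun_lindVec, if_neg hn.ne']

theorem forestSystem_lind : ForestSystem (lindBasis 𝕜) (lindCoord 𝕜) where
  biorthogonal := lindCoord_lindBasis 𝕜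
  norm_le := norm_lindVec_le
  norm_sum_apply_le _ _ _ h x := norm_sum_lindFun_apply_le h (x : ell1 𝕜)
  norm_sum_levelWeight_le N := by
    rw [norm_sum_lindBasis]
    exact norm_sum_levelWeight_lindVec_le N

theorem dominationBound_lind : DominationBound (lindBasis 𝕜) (lindCoord 𝕜) N 4 := by
  intro x z E F t _ hFE hF hE
  rcases F.eq_empty_or_nonempty with rfl | ⟨k, hk⟩
  · rw [proj_apply, Finset.sum_empty, norm_zero]
    positivity
  have ht : 0 ≤ t := (norm_nonneg _).trans (hF k hk)
  have h1 : E.card * t ≤ 2 * ‖z‖ := card_mul_le z.2 hE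
  have h2 : ∑ n ∈ F, ‖lindCoord 𝕜 n x‖ ≤ F.card * t := by
    simpa using Finset.sum_le_card_nsmul F _ t hF
  have h3 : (F.card : ℝ) * t ≤ E.card * t := by gcongr
  rw [proj_apply]
  linarith [forestSystem_lind.norm_sum_le F fun n => lindCoord 𝕜 n x]

theorem norm_greedy_proj_lind_le (x : lindSpace 𝕜) (M : ℕ) (A : Finset ℕ)
    (hA : IsGreedySet (lindCoord 𝕜) x M A) :
    ‖proj (lindBasis 𝕜) (lindCoord 𝕜) A x‖ ≤ 6 * ‖x‖ := by
  rw [proj_apply, norm_sum_lindBasis]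
  exact norm_greedy_projection_le x.2 hA.2

theorem exists_subset_log_le_norm_sum_lindBasis (N : ℕ) : ∃ B ⊆ Finset.range N,
    Real.log (N + 1) ≤ ‖∑ n ∈ B, (levelWeight n : 𝕜) • lindBasis 𝕜 n‖ := by
  obtain ⟨B, hB, h⟩ := exists_subset_norm_le (𝕜 := 𝕜)
    (fun n => (levelWeight n : 𝕜) • lindVec 𝕜 n) N
  refine ⟨B, hB, ?_⟩
  have h1 := le_norm_sum_levelSign_lindVec (𝕜 := 𝕜) N
  simp only [RCLike.ofReal_mul, mul_smul] at h1
  rw [norm_sum_lindBasis]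
  linarith [log_le_sum_levelWeight N]

theorem upperDem_lind (N : ℕ) : upperDem 𝕜 (lindBasis 𝕜) N = ENNReal.ofReal (2 * N) := by
  refine le_antisymm (upperDem_le fun A ε hA hε => ?_) ?_
  · refine (forestSystem_lind.norm_sum_le A ε).trans ?_
    simp [hε, hA]
  · refine ofReal_le_upperDem (A := Finset.Ico N (2 * N)) (by simp; omega) ?_
    have h := norm_sum_lindBasis (Finset.Ico N (2 * N)) fun _ => (1 : 𝕜)
    simp only [one_smul] at h
    rw [h]
    exact le_norm_sum_lindVec_Ico N

end Lindenstrauss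

/-! ### The sums `T_N` for linear weights -/

theorem sumT_linear_left (η : ℕ → ℝ) {N : ℕ} (hN : 1 ≤ N) :
    sumT (fun j => 2 * j) η N = 2 * η N := by
  induction N, hN using Nat.le_induction with
  | base => simp [sumT, delta]
  | succ N hN ih =>
    have h : sumT (fun j => 2 * j) η (N + 1) = sumT (fun j => 2 * j) η N +
        2 * ((N + 1 : ℕ) : ℝ) / ((N + 1 : ℕ) : ℝ) * delta η (N + 1) := by
      rw [sumT, Finset.sum_Icc_succ_top (by omega)]; rfl
    rw [h, ih, mul_div_cancel_right₀ _ (by positivity), delta, if_neg (by omega),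
      Nat.add_sub_cancel]
    ring

theorem le_sumT_linear_right {η : ℕ → ℝ} {c : ℝ} (hc : 0 ≤ c) (h : ∀ j, 1 ≤ j → c ≤ η j)
    (N : ℕ) : 2 * c * Real.log (N + 1) ≤ sumT η (fun j => 2 * j) N := by
  have h1 : Real.log (N + 1) ≤ ∑ j ∈ Finset.Icc 1 N, (j : ℝ)⁻¹ := by
    have := log_add_one_le_harmonic N
    rw [harmonic_eq_sum_Icc] at this
    push_cast at this
    exact this
  refine (mul_le_mul_of_nonneg_left h1 (by positivity)).trans ?_
  rw [Finset.mul_sum]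
  refine Finset.sum_le_sum fun j hj => ?_
  have hj1 : 1 ≤ j := (Finset.mem_Icc.1 hj).1
  have hd : delta (fun j => 2 * (j : ℝ)) j = 2 := by
    rw [delta]
    split_ifs with hj'
    · simp [hj']
    · push_cast [Nat.cast_sub hj1]; ring
  rw [hd, div_eq_mul_inv]
  have h2 : (0 : ℝ) ≤ (j : ℝ)⁻¹ := by positivity
  nlinarith [mul_le_mul_of_nonneg_right (h j hj1) h2]

end Greedy

end

theorem theorem8p3 (𝕜 : Type*) [RCLike 𝕜] :
    (∀ N, Greedy.upperDem 𝕜 (Greedy.lindBasis 𝕜) N ≠ ⊤ ∧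
      Greedy.upperDemDual (Greedy.lindCoord 𝕜) N ≠ ⊤) ∧
    Greedy.Comparable
      (fun N => ENNReal.ofReal
        (Greedy.minT (fun j => (Greedy.upperDem 𝕜 (Greedy.lindBasis 𝕜) j).toReal)
          (fun j => (Greedy.upperDemDual (Greedy.lindCoord 𝕜) j).toReal) N))
      Greedy.logSucc ∧
    Greedy.Comparable (Greedy.expLebesgue (Greedy.lindBasis 𝕜) (Greedy.lindCoord 𝕜))
      (fun _ => 1) ∧
    Greedy.Comparable (Greedy.lebesgue (Greedy.lindBasis 𝕜) (Greedy.lindCoord 𝕜))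
      Greedy.logSucc ∧
    Greedy.Comparable (Greedy.lebesgueDual (Greedy.lindBasis 𝕜) (Greedy.lindCoord 𝕜))
      Greedy.logSucc ∧
    Greedy.Comparable (Greedy.expLebesgueDual (Greedy.lindBasis 𝕜) (Greedy.lindCoord 𝕜))
      Greedy.logSucc ∧
    Greedy.Comparable (Greedy.condConst (Greedy.lindBasis 𝕜) (Greedy.lindCoord 𝕜))
      Greedy.logSucc ∧
    Greedy.Comparable (Greedy.quasiGreedyDual (Greedy.lindBasis 𝕜) (Greedy.lindCoord 𝕜))
      Greedy.logSucc ∧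
    Greedy.Comparable (Greedy.superDemDual (Greedy.lindCoord 𝕜)) Greedy.logSucc := by
  open Greedy in
  refine ⟨fun N => ⟨?_, forestSystem_lind.upperDemDual_ne_top N⟩, ?_, ?_, ?_, ?_, ?_, ?_, ?_, ?_⟩
  · rw [upperDem_lind]
    exact ENNReal.ofReal_ne_top
  · have hD : (fun j => (upperDem 𝕜 (lindBasis 𝕜) j).toReal) = fun j : ℕ => 2 * (j : ℝ) := by
      funext j
      rw [upperDem_lind, ENNReal.toReal_ofReal (by positivity)]
    set η : ℕ → ℝ := fun j => (upperDemDual (lindCoord 𝕜) j).toReal with hη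
    have hlow : ∀ N : ℕ, 1 / 4 * Real.log (N + 1) ≤ η N := fun N =>
      (ENNReal.ofReal_le_iff_le_toReal (forestSystem_lind.upperDemDual_ne_top N)).1
        (forestSystem_lind.le_upperDemDual N)
    refine comparable_logSucc (c := 1 / 4) (C := 12) (by norm_num) (by norm_num)
      (fun N hN => ENNReal.ofReal_le_ofReal ?_) (fun N hN => ENNReal.ofReal_le_ofReal ?_)
    · have hl := half_le_log hN
      rw [hD, minT, sumT_linear_left η hN]
      refine le_min (by linarith [hlow N]) ?_
      refine le_trans ?_ (le_sumT_linear_right (c := 1 / 8) (by norm_num) (fun j hj => ?_) N)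
      · linarith
      · linarith [hlow j, half_le_log hj]
    · have hl := half_le_log hN
      rw [hD, minT, sumT_linear_left η hN]
      have h : η N ≤ 6 * Real.log (N + 1) :=
        ENNReal.toReal_le_of_le_ofReal (by linarith) (forestSystem_lind.upperDemDual_le hN)
      exact (min_le_left _ _).trans (by linarith)
  · refine ⟨1, 11, one_pos, by norm_num, fun N _ => ⟨?_, ?_⟩⟩
    · simpa using (forestSystem_lind (𝕜 := 𝕜)).one_le_expLebesgue tendsto_lindCoord N
    · refine (dominationBound_lind.expLebesgue_le (lindCoord_lindBasis 𝕜)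
        norm_greedy_proj_lind_le (by norm_num) (by norm_num)).trans ?_
      norm_num
  · refine comparable_logSucc (c := 1 / 4) (C := 34) (by norm_num) (by norm_num)
      (fun N _ => ?_) fun N hN => ?_
    · obtain ⟨B, hB, h⟩ := exists_subset_log_le_norm_sum_lindBasis (𝕜 := 𝕜) N
      exact forestSystem_lind.le_lebesgue tendsto_lindCoord hB h
    have hl := half_le_log hN
    exact (dominationBound_lind.lebesgue_le (K := 24 * Real.log (N + 1)) (lindCoord_lindBasis 𝕜)
      (fun A hA => forestSystem_lind.norm_proj_double_le hA hN) (by linarith) (by norm_num)).trans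
      (ENNReal.ofReal_le_ofReal (by linarith))
  · exact forestSystem_lind.comparable_lebesgueDual
  · exact forestSystem_lind.comparable_expLebesgueDual
  · exact comparable_logSucc (c := 1 / 4) (C := 12) (by norm_num) (by norm_num)
      (fun N hN => by
        obtain ⟨B, hB, h⟩ := exists_subset_log_le_norm_sum_lindBasis (𝕜 := 𝕜) N
        exact forestSystem_lind.le_condConst hN hB h)
      fun N hN => condConst_le fun A hA => forestSystem_lind.norm_proj_le hA hN
  · exact forestSystem_lind.comparable_quasiGreedyDual
  · exact forestSystem_lind.comparable_superDemDual
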